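/- Let $W$ be a vector space over $\mathbb C$ and $\mathcal E(W)=\mathrm{Hom}(W,W((x)))$; write $1_W\in\mathcal E(W)$ for the identity operator (constant series). A finite sequence $(\psi^{(1)},\dots,\psi^{(r)})$ in $\mathcal E(W)$ is *quasi compatible* if there is a nonzero polynomial $p(x,y)\in\mathbb C[x,y]$ with $$\Big(\prod_{1\le i<j\le r}p(x_i,x_j)\Big)\psi^{(1)}(x_1)\cdots\psi^{(r)}(x_r)\in\mathrm{Hom}\big(W,W((x_1,\dots,x_r))\big),$$ where $W((x_1,\dots,x_r))=W[[x_1,\dots,x_r]][x_1^{-1},\dots,x_r^{-1}]$. For a quasi compatible pair $(a(x),b(x))$ define $a(x)_nb(x)\in\mathcal E(W)$, $n\in\mathbb Z$, by $$Y_{\mathcal E}(a(x),x_0)b(x)=\sum_{n\in\mathbb Z}(a(x)_nb(x))\,x_0^{-n-1}=\iota_{x,x_0}\big(p(x+x_0,x)^{-1}\big)\,\big(p(x_1,x)a(x_1)b(x)\big)\big|_{x_1=x+x_0},$$ where $p$ is any nonzero polynomial with $p(x_1,x_2)a(x_1)b(x_2)\in\mathrm{Hom}(W,W((x_1,x_2)))$,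 $\iota_{x,x_0}$ expands rational functions in $\mathbb C((x))((x_0))$, and powers of $x+x_0$ are expanded in nonnegative powers of $x_0$ (the result does not depend on $p$). A subspace $V\subset\mathcal E(W)$ all of whose ordered pairs are quasi compatible is *closed* if $a(x)_nb(x)\in V$ for all $a(x),b(x)\in V$ and $n\in\mathbb Z$. A *nonlocal vertex algebra* is a vector space $V$ over $\mathbb C$ with a linear map $Y(\cdot,x):V\to\mathrm{Hom}(V,V((x)))$ and a vector $\mathbf 1\in V$ such that $Y(\mathbf 1,x)v=v$, $Y(v,x)\mathbf 1\in V[[x]]$ and $\lim_{x\to0}Y(v,x)\mathbf 1=v$ for all $v\in V$, and such that for all $u,v,w\in V$ there is an integer $l\ge0$ with $$(x_0+x_2)^lY(u,x_0+x_2)Y(v,x_2)w=(x_0+x_2)^lY(Y(u,x_0)v,x_2)w .$$ A *quasi $V$-module* is a vector space $M$ over $\mathbb C$ with a linear map $Y_M(\cdot,x):V\to\mathrm{Hom}(M,M((x)))$ such that $Y_M(\mathbf 1,x)=1_M$ and such that for all $u,v\in V$, $w\in M$ there is a nonzero polynomial $f(x_1,x_2)$ with $$f(x_0+x_2,x_2)Y_M(u,x_0+x_2)Y_M(v,x_2)w=f(x_0+x_2,x_2)Y_M(Y(u,x_0)v,x_2)w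 .$$ (Powers of $x_0+x_2$ inside $Y$ and $Y_M$ are expanded in nonnegative powers of $x_2$.) It is *faithful* if $Y_M$ is injective. **Theorem.** Let $V$ be a closed subspace of $\mathcal E(W)$ such that every sequence in $V$ of length $2$ or $3$ is quasi compatible and $1_W\in V$. Then $(V,Y_{\mathcal E},1_W)$ is a nonlocal vertex algebra, and $W$ is a faithful quasi $V$-module with vertex operator map $Y_W$ given by $Y_W(\alpha(x),x_0)=\alpha(x_0)$ for $\alpha(x)\in V$. -/

import Mathlib

/-!
Formal series are treated coefficientwise.  `VertexOperator ℂ W` is Mathlib's type of linear maps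
`W → W((x))`, and `HVertexOperator.coeff a n` is the coefficient of `x ^ n` in `a(x)`, while
`VertexOperator.ncoeff a n` is the coefficient of `x ^ (-n - 1)`.
-/

noncomputable section

namespace QuasiVertex

open MvPolynomial

/-- `E(W) = Hom(W, W((x)))`. -/
abbrev E (W : Type*) [AddCommGroup W] [Module ℂ W] := VertexOperator ℂ W

/-- Formal series `U[[x₁^{±1}, …, x_r^{±1}]]`, unrestricted in all directions:
`F m` is the coefficient of `x₁ ^ m₁ ⋯ x_r ^ m_r`. -/
abbrev FormalSeries (r : ℕ) (U : Type*) := (Fin r → ℤ) → U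

section Series

variable {r : ℕ} {U : Type*} [AddCommGroup U] [Module ℂ U]

/-- The product of a polynomial in `x₁, …, x_r` with a formal series. -/
def polyMul (q : MvPolynomial (Fin r) ℂ) (F : FormalSeries r U) : FormalSeries r U :=
  fun m => ∑ d ∈ q.support, q.coeff d • F (fun i => m i - (d i : ℤ))

/-- `F ∈ U((x₁, …, x_r)) = U[[x₁, …, x_r]][x₁⁻¹, …, x_r⁻¹]`. -/
def IsLowerTruncated (F : FormalSeries r U) : Prop :=
  ∃ N : ℤ, ∀ m : Fin r → ℤ, F m ≠ 0 → ∀ i, N ≤ m i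

end Series

section Operators

variable {W : Type*} [AddCommGroup W] [Module ℂ W]

/-- The identity operator `1_W`, viewed as the constant series in `E(W)`. -/
def idSeries (W : Type*) [AddCommGroup W] [Module ℂ W] : E W where
  toFun w := HahnModule.of ℂ (HahnSeries.single 0 w)
  map_add' v w := by simp
  map_smul' c w := by
    refine HahnModule.ext _ _ (funext fun n => ?_)
    change (HahnSeries.single 0 (c • w)).coeff n = c • (HahnSeries.single 0 w).coeff n
    by_cases h : n = 0 <;> simp [h]

/-- `ψ⁽¹⁾(x₁) ⋯ ψ⁽ʳ⁾(x_r) w` as a formal series in `x₁, …, x_r`. -/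
def opProd {r : ℕ} (ψ : Fin r → E W) (w : W) : FormalSeries r W :=
  fun m => ((List.ofFn fun i => (HVertexOperator.coeff (ψ i) (m i) : Module.End ℂ W)).prod) w

/-- `q(x₁, …, x_r) ψ⁽¹⁾(x₁) ⋯ ψ⁽ʳ⁾(x_r) ∈ Hom(W, W((x₁, …, x_r)))`. -/
def Clears {r : ℕ} (q : MvPolynomial (Fin r) ℂ) (ψ : Fin r → E W) : Prop :=
  ∀ w : W, IsLowerTruncated (polyMul q (opProd ψ w))

/-- `∏_{i < j} p(x_i, x_j)`. -/
def pairwiseProd (r : ℕ) (p : MvPolynomial (Fin 2) ℂ) : MvPolynomial (Fin r) ℂ :=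
  ∏ i : Fin r, ∏ j ∈ Finset.Ioi i, rename ![i, j] p

/-- Quasi compatibility of a finite sequence in `E(W)`. -/
def QuasiCompatible {r : ℕ} (ψ : Fin r → E W) : Prop :=
  ∃ p : MvPolynomial (Fin 2) ℂ, p ≠ 0 ∧ Clears (pairwiseProd r p) ψ

theorem pairwiseProd_two (p : MvPolynomial (Fin 2) ℂ) : pairwiseProd 2 p = p := by
  have h0 : (Finset.Ioi (0 : Fin 2)) = {1} := by decide
  have h1 : (Finset.Ioi (1 : Fin 2)) = ∅ := by decide
  have h2 : (![0, 1] : Fin 2 → Fin 2) = id := by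
    funext i; fin_cases i <;> rfl
  simp [pairwiseProd, Fin.prod_univ_two, h0, h1, h2]

theorem quasiCompatible_pair_iff (a b : E W) :
    QuasiCompatible ![a, b] ↔ ∃ p : MvPolynomial (Fin 2) ℂ, p ≠ 0 ∧ Clears p ![a, b] := by
  simp only [QuasiCompatible, pairwiseProd_two]

end Operators

section Substitution

variable {W : Type*} [AddCommGroup W] [Module ℂ W]

/-- `W((x))`, a vector space over the field `ℂ((x))`. -/
abbrev Laurent (W : Type*) [AddCommGroup W] [Module ℂ W] := HahnModule ℤ ℂ W

/-- `W((x))((x₀))`, a vector space over the field `ℂ((x))((x₀))`; the outer exponent is that of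
`x₀`, the inner one that of `x`. -/
abbrev IterLaurent (W : Type*) [AddCommGroup W] [Module ℂ W] :=
  HahnModule ℤ (LaurentSeries ℂ) (Laurent W)

/-- The coefficient of `x₀ ^ k x ^ s` in `F(x + x₀, x)` for `F(x₁, x) ∈ W((x₁, x))`, with
`(x + x₀) ^ i` expanded in nonnegative powers of `x₀`. -/
def substCoeff {U : Type*} [AddCommGroup U] (F : FormalSeries 2 U) (k : ℕ) (s : ℤ) : U :=
  ∑ᶠ i : ℤ, Ring.choose i k • F ![i, s + k - i]

theorem substCoeff_support {U : Type*} [AddCommGroup U] {F : FormalSeries 2 U} {N : ℤ}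
    (hN : ∀ m : Fin 2 → ℤ, F m ≠ 0 → ∀ i, N ≤ m i) (k : ℕ) (s : ℤ) :
    (Function.support fun i : ℤ => Ring.choose i k • F ![i, s + k - i])
      ⊆ Finset.Icc N (s + k - N) := by
  intro i hi
  have h1 : F ![i, s + k - i] ≠ 0 := fun h => hi (by simp [h])
  have h2 := hN _ h1 0
  have h3 := hN _ h1 1
  simp at h2 h3
  simp
  omega

theorem substCoeff_finite {U : Type*} [AddCommGroup U] {F : FormalSeries 2 U} (hF : IsLowerTruncated F) (k : ℕ) (s : ℤ) :
    (Function.support fun i : ℤ => Ring.choose i k • F ![i, s + k - i]).Finite := by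
  obtain ⟨N, hN⟩ := hF
  exact (Finset.finite_toSet _).subset (substCoeff_support hN k s)

theorem substCoeff_bddBelow {U : Type*} [AddCommGroup U] {F : FormalSeries 2 U} (hF : IsLowerTruncated F) (k : ℕ) :
    BddBelow (Function.support (substCoeff F k)) := by
  obtain ⟨N, hN⟩ := hF
  refine ⟨2 * N - k, fun s hs => ?_⟩
  by_contra hlt
  apply hs
  have hempty : (Function.support fun i : ℤ => Ring.choose i k • F ![i, s + k - i]) = ∅ := by
    apply Set.eq_empty_of_subset_empty
    intro i hi
    have := substCoeff_support hN k s hi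
    simp at this
    omega
  unfold substCoeff
  exact finsum_eq_zero_of_forall_eq_zero fun i => by
    have : i ∉ (Function.support fun i : ℤ => Ring.choose i k • F ![i, s + k - i]) := by
      rw [hempty]; simp
    simpa [Function.mem_support] using this

/-- `F(x + x₀, x) ∈ W((x))((x₀))` for `F(x₁, x) ∈ W((x₁, x))`, with `(x + x₀) ^ i` expanded in
nonnegative powers of `x₀`. -/
def subst (F : FormalSeries 2 W) (hF : IsLowerTruncated F) : IterLaurent W :=
  HahnModule.of (LaurentSeries ℂ) <| HahnSeries.ofSuppBddBelow
    (fun n : ℤ => if 0 ≤ n then HahnModule.of ℂ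
      (HahnSeries.ofSuppBddBelow (substCoeff F n.toNat) (substCoeff_bddBelow hF n.toNat)) else 0)
    (show BddBelow _ from ⟨0, fun n hn => by
      by_contra h
      exact hn (by simp only [if_neg h])⟩)

/-- The coefficient of `x₀ ^ n x ^ s` of an element of `W((x))((x₀))`. -/
def iterCoeff (G : IterLaurent W) (n s : ℤ) : W :=
  ((HahnModule.of ℂ).symm (((HahnModule.of (LaurentSeries ℂ)).symm G).coeff n)).coeff s

theorem iterCoeff_ext {G H : IterLaurent W} (h : ∀ n s, iterCoeff G n s = iterCoeff H n s) :
    G = H := by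
  ext n s
  exact h n s

theorem iterCoeff_subst (F : FormalSeries 2 W) (hF : IsLowerTruncated F) (n s : ℤ) :
    iterCoeff (subst F hF) n s = if 0 ≤ n then substCoeff F n.toNat s else 0 := by
  unfold iterCoeff
  by_cases h : 0 ≤ n
  · rw [if_pos h, show ((HahnModule.of (LaurentSeries ℂ)).symm (subst F hF)).coeff n =
      HahnModule.of ℂ (HahnSeries.ofSuppBddBelow (substCoeff F n.toNat)
        (substCoeff_bddBelow hF n.toNat)) from if_pos h]
    rfl
  · rw [if_neg h, show ((HahnModule.of (LaurentSeries ℂ)).symm (subst F hF)).coeff n = 0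
      from if_neg h]
    rfl

/-- `p(x + x₀, x)` in the field `ℂ((x))((x₀))`. -/
def shiftedPoly (p : MvPolynomial (Fin 2) ℂ) : LaurentSeries (LaurentSeries ℂ) :=
  eval₂ ((HahnSeries.C : LaurentSeries ℂ →+* LaurentSeries (LaurentSeries ℂ)).comp HahnSeries.C)
    ![HahnSeries.single 0 (HahnSeries.single 1 1) + HahnSeries.single 1 1,
      HahnSeries.single 0 (HahnSeries.single 1 1)] p


theorem iterCoeff_add (G H : IterLaurent W) (n s : ℤ) :
    iterCoeff (G + H) n s = iterCoeff G n s + iterCoeff H n s := rfl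

theorem iterCoeff_single_smul (c : ℂ) (i j : ℤ) (G : IterLaurent W) (n s : ℤ) :
    iterCoeff ((HahnSeries.single i (HahnSeries.single j c) : LaurentSeries (LaurentSeries ℂ)) • G)
      n s = c • iterCoeff G (n - i) (s - j) := by
  have h1 := HahnModule.coeff_single_smul_vadd (r := (HahnSeries.single j c : LaurentSeries ℂ))
    (x := G) (a := n - i) (b := i)
  have h2 := HahnModule.coeff_single_smul_vadd (r := c)
    (x := ((HahnModule.of (LaurentSeries ℂ)).symm G).coeff (n - i)) (a := s - j) (b := j)
  rw [vadd_eq_add, add_sub_cancel] at h1 h2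
  exact (congrArg (fun z : Laurent W => ((HahnModule.of ℂ).symm z).coeff s) h1).trans h2

theorem polyMul_eq_sum {r : ℕ} (q : MvPolynomial (Fin r) ℂ) (F : FormalSeries r W)
    (m : Fin r → ℤ) {S : Finset (Fin r →₀ ℕ)} (hS : q.support ⊆ S) :
    polyMul q F m = ∑ d ∈ S, q.coeff d • F (fun i => m i - (d i : ℤ)) := by
  refine Finset.sum_subset hS fun d _ hd => ?_
  rw [notMem_support_iff.mp hd, zero_smul]

theorem polyMul_add {r : ℕ} (p q : MvPolynomial (Fin r) ℂ) (F : FormalSeries r W) :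
    polyMul (p + q) F = polyMul p F + polyMul q F := by
  classical
  funext m
  rw [Pi.add_apply, polyMul_eq_sum (p + q) F m support_add,
    polyMul_eq_sum p F m Finset.subset_union_left, polyMul_eq_sum q F m Finset.subset_union_right,
    ← Finset.sum_add_distrib]
  simp only [coeff_add, add_smul]

theorem polyMul_C {r : ℕ} (c : ℂ) (F : FormalSeries r W) :
    polyMul (C c) F = c • F := by
  classical
  funext m
  rw [polyMul_eq_sum (C c) F m (S := {0})]
  · simp
  · intro d hd
    simp only [mem_support_iff, coeff_C, ne_eq, ite_eq_right_iff, Classical.not_imp] at hd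
    simp [hd.1.symm]

theorem polyMul_mul_X {r : ℕ} (q : MvPolynomial (Fin r) ℂ) (i : Fin r) (F : FormalSeries r W)
    (m : Fin r → ℤ) : polyMul (q * X i) F m = polyMul q F (fun j => m j - if j = i then 1 else 0) := by
  classical
  unfold polyMul
  rw [support_mul_X, Finset.sum_map]
  refine Finset.sum_congr rfl fun d _ => ?_
  simp only [addRightEmbedding_apply, coeff_mul_X]
  congr 2
  funext j
  by_cases h : j = i
  · subst h; simp; ring
  · simp [h]

theorem IsLowerTruncated.polyMul {r : ℕ} {F : FormalSeries r W} (hF : IsLowerTruncated F)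
    (q : MvPolynomial (Fin r) ℂ) : IsLowerTruncated (polyMul q F) := by
  obtain ⟨N, hN⟩ := hF
  refine ⟨N, fun m hm i => ?_⟩
  obtain ⟨d, _, hd⟩ := Finset.exists_ne_zero_of_sum_ne_zero hm
  have := hN _ (fun h => hd (by rw [h, smul_zero])) i
  omega

theorem polyMul_X_zero_two (F : FormalSeries 2 W) (i j : ℤ) :
    polyMul (X 0) F ![i, j] = F ![i - 1, j] := by
  have h := polyMul_mul_X 1 0 F ![i, j]
  rw [one_mul, ← C_1, polyMul_C, one_smul] at h
  rw [h]
  congr 1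
  funext k
  fin_cases k <;> simp

theorem polyMul_X_one_two (F : FormalSeries 2 W) (i j : ℤ) :
    polyMul (X 1) F ![i, j] = F ![i, j - 1] := by
  have h := polyMul_mul_X 1 1 F ![i, j]
  rw [one_mul, ← C_1, polyMul_C, one_smul] at h
  rw [h]
  congr 1
  funext k
  fin_cases k <;> simp

theorem polyMul_mul {r : ℕ} (p q : MvPolynomial (Fin r) ℂ) (F : FormalSeries r W) :
    polyMul (p * q) F = polyMul p (polyMul q F) := by
  induction p using MvPolynomial.induction_on generalizing q F with
  | C c =>
    rw [polyMul_C]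
    induction q using MvPolynomial.induction_on generalizing F with
    | C d => rw [← C_mul, polyMul_C, polyMul_C, mul_smul]
    | add p q hp hq => rw [mul_add, polyMul_add, hp, hq, polyMul_add, smul_add]
    | mul_X p i hp =>
      funext m
      rw [← mul_assoc, polyMul_mul_X, hp, Pi.smul_apply, Pi.smul_apply, polyMul_mul_X]
  | add p p' hp hp' => rw [add_mul, polyMul_add, hp, hp', polyMul_add]
  | mul_X p i hp =>
    have h : polyMul (X i * q) F = polyMul (X i) (polyMul q F) := by
      funext m
      have h1 := polyMul_mul_X 1 i (polyMul q F) m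
      rw [one_mul, ← C_1, polyMul_C, one_smul] at h1
      rw [mul_comm, polyMul_mul_X, h1]
    rw [mul_assoc, hp, h, ← hp]

theorem subst_add (F G : FormalSeries 2 W) (hF : IsLowerTruncated F) (hG : IsLowerTruncated G)
    (hFG : IsLowerTruncated (F + G)) : subst (F + G) hFG = subst F hF + subst G hG := by
  refine iterCoeff_ext fun n s => ?_
  simp only [iterCoeff_add, iterCoeff_subst]
  split_ifs
  · unfold substCoeff
    rw [← finsum_add_distrib (substCoeff_finite hF _ _) (substCoeff_finite hG _ _)]
    simp only [Pi.add_apply, smul_add]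
  · simp

theorem subst_smul (c : ℂ) (F : FormalSeries 2 W) (hF : IsLowerTruncated F)
    (hcF : IsLowerTruncated (c • F)) : subst (c • F) hcF =
      (HahnSeries.single 0 (HahnSeries.single 0 c) : LaurentSeries (LaurentSeries ℂ)) •
        subst F hF := by
  refine iterCoeff_ext fun n s => ?_
  simp only [iterCoeff_single_smul, iterCoeff_subst, sub_zero]
  split_ifs
  · unfold substCoeff
    rw [smul_finsum]
    exact finsum_congr fun i => smul_comm _ _ _
  · simp

theorem shiftedPoly_X_zero : shiftedPoly (X 0) =
    HahnSeries.single 0 (HahnSeries.single 1 1) +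
      HahnSeries.single 1 (HahnSeries.single 0 1) := by
  simp [shiftedPoly]

theorem shiftedPoly_X_one : shiftedPoly (X 1) =
    HahnSeries.single 0 (HahnSeries.single 1 1) := by
  simp [shiftedPoly]

theorem shiftedPoly_C (c : ℂ) : shiftedPoly (C c) =
    HahnSeries.single 0 (HahnSeries.single 0 c) := by
  rw [shiftedPoly, eval₂_C]
  rfl

theorem add_smul_iter (f g : LaurentSeries (LaurentSeries ℂ)) (G : IterLaurent W) :
    (f + g) • G = f • G + g • G :=
  HahnModule.add_smul (R := LaurentSeries ℂ) (V := Laurent W) fun _ _ _ =>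
    HahnModule.add_smul (R := ℂ) (V := W) fun r s u => Module.add_smul r s u

theorem mul_smul_iter (f g : LaurentSeries (LaurentSeries ℂ)) (G : IterLaurent W) :
    (f * g) • G = f • g • G := by
  let i : Module (LaurentSeries (LaurentSeries ℂ)) (IterLaurent W) := inferInstance
  with_unfolding_all exact i.mul_smul f g G

theorem subst_X_zero (F : FormalSeries 2 W) (hF : IsLowerTruncated F) :
    subst (polyMul (X 0) F) (hF.polyMul _) = shiftedPoly (X 0) • subst F hF := by
  refine iterCoeff_ext fun n s => ?_
  rw [shiftedPoly_X_zero, add_smul_iter, iterCoeff_add, iterCoeff_single_smul,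
    iterCoeff_single_smul]
  simp only [iterCoeff_subst, sub_zero, one_smul]
  rcases lt_trichotomy n 0 with hn | rfl | hn
  · rw [if_neg (by omega), if_neg (by omega), if_neg (by omega), add_zero]
  · rw [if_pos le_rfl, if_pos le_rfl, if_neg (by omega), add_zero]
    unfold substCoeff
    rw [← finsum_comp_equiv (Equiv.addRight (1 : ℤ))]
    refine finsum_congr fun i => ?_
    rw [polyMul_X_zero_two]
    simp only [Equiv.coe_addRight, Int.toNat_zero, Ring.choose_zero_right]
    congr 3
    · ring
    · congr 1
      push_cast
      ring
  · obtain ⟨k, rfl⟩ : ∃ k : ℕ, n = (k + 1 : ℕ) := ⟨(n - 1).toNat, by omega⟩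
    rw [if_pos (by omega), if_pos (by omega), if_pos (by omega),
      show ((k + 1 : ℕ) : ℤ).toNat = k + 1 by omega,
      show (((k + 1 : ℕ) : ℤ) - 1).toNat = k by omega]
    unfold substCoeff
    rw [← finsum_add_distrib (substCoeff_finite hF _ _) (substCoeff_finite hF _ _),
      ← finsum_comp_equiv (Equiv.addRight (1 : ℤ))]
    refine finsum_congr fun i => ?_
    rw [polyMul_X_zero_two]
    simp only [Equiv.coe_addRight, Ring.choose_succ_succ]
    have e1 : s + ((k + 1 : ℕ) : ℤ) - (i + 1) = s + k - i := by push_cast; ring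
    have e2 : s - 1 + ((k + 1 : ℕ) : ℤ) - i = s + k - i := by push_cast; ring
    rw [e1, e2, add_sub_cancel_right, add_comm, _root_.add_smul]

theorem subst_X_one (F : FormalSeries 2 W) (hF : IsLowerTruncated F) :
    subst (polyMul (X 1) F) (hF.polyMul _) = shiftedPoly (X 1) • subst F hF := by
  refine iterCoeff_ext fun n s => ?_
  rw [shiftedPoly_X_one, iterCoeff_single_smul]
  simp only [iterCoeff_subst, sub_zero, one_smul]
  split_ifs
  · unfold substCoeff
    refine finsum_congr fun i => ?_
    rw [polyMul_X_one_two]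
    congr 3
    ring_nf
  · rfl

theorem shiftedPoly_mul (p q : MvPolynomial (Fin 2) ℂ) :
    shiftedPoly (p * q) = shiftedPoly p * shiftedPoly q :=
  eval₂_mul _ _

/-- The monomial `c x₀ ^ i x ^ j` of `ℂ((x))((x₀))` as a product of its factors. -/
theorem single_eq_mul_pow (c : ℂ) (i j : ℕ) :
    ((HahnSeries.C : LaurentSeries ℂ →+* LaurentSeries (LaurentSeries ℂ)).comp HahnSeries.C) c *
      ((HahnSeries.single 1 1 : LaurentSeries (LaurentSeries ℂ)) ^ i *
        (HahnSeries.single 0 (HahnSeries.single 1 1)) ^ j) =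
    HahnSeries.single (i : ℤ) (HahnSeries.single (j : ℤ) c) := by
  simp [HahnSeries.C_apply, HahnSeries.single_pow, HahnSeries.single_mul_single]

theorem eval₂_monomials_injective (q : MvPolynomial (Fin 2) ℂ)
    (hq : (eval₂ ((HahnSeries.C : LaurentSeries ℂ →+* LaurentSeries (LaurentSeries ℂ)).comp
      HahnSeries.C) ![HahnSeries.single 1 1, HahnSeries.single 0 (HahnSeries.single 1 1)] q :
        LaurentSeries (LaurentSeries ℂ)) = 0) :
    q = 0 := by
  classical
  rw [eval₂_eq'] at hq
  simp only [Fin.prod_univ_two, Matrix.cons_val_zero, Matrix.cons_val_one,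
    single_eq_mul_pow] at hq
  ext d
  have h := congrArg (fun z : LaurentSeries (LaurentSeries ℂ) => z.coeff (d 0 : ℤ)) hq
  simp only [HahnSeries.coeff_sum, HahnSeries.coeff_zero] at h
  have h' := congrArg (fun z : LaurentSeries ℂ => z.coeff (d 1 : ℤ)) h
  simp only [HahnSeries.coeff_sum, HahnSeries.coeff_zero] at h'
  rw [Finset.sum_eq_single d] at h'
  · simpa using h'
  · intro e _ hed
    by_cases h0 : e 0 = d 0
    · by_cases h1 : e 1 = d 1
      · exact absurd (Finsupp.ext fun k => by fin_cases k <;> assumption) hed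
      · rw [h0, HahnSeries.coeff_single_same, HahnSeries.coeff_single_of_ne]
        exact fun h => h1 (by exact_mod_cast h.symm)
    · rw [HahnSeries.coeff_single_of_ne (fun h => h0 (by exact_mod_cast h.symm))]
      rfl
  · intro hd
    simp [notMem_support_iff.mp hd]

theorem shiftedPoly_ne_zero {p : MvPolynomial (Fin 2) ℂ} (hp : p ≠ 0) : shiftedPoly p ≠ 0 := by
  intro h
  have h1 : bind₁ ![X 1 + X 0, X 1] p = (0 : MvPolynomial (Fin 2) ℂ) := by
    apply eval₂_monomials_injective
    let φ : ℂ →+* LaurentSeries (LaurentSeries ℂ) :=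
      (HahnSeries.C : LaurentSeries ℂ →+* LaurentSeries (LaurentSeries ℂ)).comp HahnSeries.C
    let g : Fin 2 → LaurentSeries (LaurentSeries ℂ) :=
      ![HahnSeries.single 1 1, HahnSeries.single 0 (HahnSeries.single 1 1)]
    have e := eval₂Hom_bind₁ φ g (![X 1 + X 0, X 1] : Fin 2 → MvPolynomial (Fin 2) ℂ) p
    rw [coe_eval₂Hom, coe_eval₂Hom] at e
    refine e.trans (Eq.trans ?_ h)
    unfold shiftedPoly
    congr 1
    funext k
    fin_cases k <;> simp [g]
  have h2 : bind₁ ![X 0 - X 1, X 1] (bind₁ ![X 1 + X 0, X 1] p) = p := by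
    rw [bind₁_bind₁]
    conv_rhs => rw [← AlgHom.id_apply (R := ℂ) p, ← bind₁_X_left]
    congr 2
    funext k
    fin_cases k <;> simp
  rw [h1, map_zero] at h2
  exact hp h2.symm

theorem subst_congr {F G : FormalSeries 2 W} (h : F = G) (hF : IsLowerTruncated F)
    (hG : IsLowerTruncated G) : subst F hF = subst G hG := by
  subst h; rfl

/-- Substitution `x₁ = x + x₀` is compatible with multiplication by polynomials. -/
theorem subst_polyMul (p : MvPolynomial (Fin 2) ℂ) (F : FormalSeries 2 W)
    (hF : IsLowerTruncated F) :
    subst (polyMul p F) (hF.polyMul p) = shiftedPoly p • subst F hF := by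
  induction p using MvPolynomial.induction_on generalizing F with
  | C c =>
    have h : IsLowerTruncated (c • F) := by rw [← polyMul_C]; exact hF.polyMul _
    rw [shiftedPoly_C, ← subst_smul c F hF h]
    exact QuasiVertex.subst_congr (polyMul_C c F) _ _
  | add p q hp hq =>
    have h : IsLowerTruncated (polyMul p F + polyMul q F) := by
      rw [← polyMul_add]; exact hF.polyMul _
    rw [QuasiVertex.subst_congr (polyMul_add p q F) _ h,
      subst_add _ _ (hF.polyMul p) (hF.polyMul q) h, hp, hq]
    rw [show shiftedPoly (p + q) = shiftedPoly p + shiftedPoly q from eval₂_add _ _, add_smul_iter]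
  | mul_X p i hp =>
    rw [QuasiVertex.subst_congr (polyMul_mul p (X i) F) _ ((hF.polyMul _).polyMul _),
      hp _ (hF.polyMul _), shiftedPoly_mul, mul_smul_iter]
    congr 1
    fin_cases i
    · exact subst_X_zero F hF
    · exact subst_X_one F hF

end Substitution

section Products

variable {W : Type*} [AddCommGroup W] [Module ℂ W]

theorem opProd_add {r : ℕ} (ψ : Fin r → E W) (v w : W) :
    opProd ψ (v + w) = opProd ψ v + opProd ψ w := by
  funext m; simp [opProd]

theorem opProd_smul {r : ℕ} (ψ : Fin r → E W) (c : ℂ) (w : W) :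
    opProd ψ (c • w) = c • opProd ψ w := by
  funext m; simp [opProd]

theorem polyMul_add_right {r : ℕ} (q : MvPolynomial (Fin r) ℂ) (F G : FormalSeries r W) :
    polyMul q (F + G) = polyMul q F + polyMul q G := by
  funext m; simp [polyMul, Finset.sum_add_distrib]

theorem polyMul_smul_right {r : ℕ} (q : MvPolynomial (Fin r) ℂ) (c : ℂ) (F : FormalSeries r W) :
    polyMul q (c • F) = c • polyMul q F := by
  funext m; simp [polyMul, Finset.smul_sum, smul_comm c]

/-- `ι_{x,x₀}(p(x + x₀, x)⁻¹) ((p(x₁, x) a(x₁) b(x) w)|_{x₁ = x + x₀}) ∈ W((x))((x₀))`, for a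
polynomial `p` with `p(x₁, x) a(x₁) b(x) ∈ Hom(W, W((x₁, x)))`. -/
def operatorProduct (p : MvPolynomial (Fin 2) ℂ) (a b : E W) (h : Clears p ![a, b]) (w : W) :
    IterLaurent W :=
  (shiftedPoly p)⁻¹ • subst (polyMul p (opProd ![a, b] w)) (h w)

/-- `operatorProduct` does not depend on the polynomial `p`. -/
theorem operatorProduct_eq (p q : MvPolynomial (Fin 2) ℂ) (hp0 : p ≠ 0) (hq0 : q ≠ 0) (a b : E W)
    (hp : Clears p ![a, b]) (hq : Clears q ![a, b]) (w : W) :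
    operatorProduct p a b hp w = operatorProduct q a b hq w := by
  have hp' := shiftedPoly_ne_zero hp0
  have hq' := shiftedPoly_ne_zero hq0
  have h1 := subst_polyMul q _ (hp w)
  have h2 := subst_polyMul p _ (hq w)
  have h3 : polyMul q (polyMul p (opProd ![a, b] w)) = polyMul p (polyMul q (opProd ![a, b] w)) := by
    rw [← polyMul_mul, ← polyMul_mul, mul_comm]
  rw [subst_congr h3 _ ((hq w).polyMul p), h2] at h1
  have key : ∀ (f g : LaurentSeries (LaurentSeries ℂ)), f ≠ 0 → g ≠ 0 → ∀ G H : IterLaurent W,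
      f • H = g • G → f⁻¹ • G = g⁻¹ • H := by
    intro f g hf hg G H h
    have h' := congrArg (fun z : IterLaurent W => (f⁻¹ * g⁻¹) • z) h
    simp only [← mul_smul_iter] at h'
    rw [show f⁻¹ * g⁻¹ * f = g⁻¹ by field_simp, show f⁻¹ * g⁻¹ * g = f⁻¹ by field_simp] at h'
    exact h'.symm
  exact key _ _ hp' hq' _ _ h1

theorem operatorProduct_add (p : MvPolynomial (Fin 2) ℂ) (a b : E W) (h : Clears p ![a, b])
    (v w : W) :
    operatorProduct p a b h (v + w) = operatorProduct p a b h v + operatorProduct p a b h w := by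
  have e : polyMul p (opProd ![a, b] (v + w)) =
      polyMul p (opProd ![a, b] v) + polyMul p (opProd ![a, b] w) := by
    rw [opProd_add, polyMul_add_right]
  unfold operatorProduct
  rw [subst_congr e _ (e ▸ h (v + w)), subst_add _ _ (h v) (h w)]
  exact HahnModule.smul_add _ _ _

theorem operatorProduct_smul (p : MvPolynomial (Fin 2) ℂ) (a b : E W) (h : Clears p ![a, b])
    (c : ℂ) (w : W) :
    operatorProduct p a b h (c • w) =
      (HahnSeries.single 0 (HahnSeries.single 0 c) : LaurentSeries (LaurentSeries ℂ)) •
        operatorProduct p a b h w := by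
  have e : polyMul p (opProd ![a, b] (c • w)) = c • polyMul p (opProd ![a, b] w) := by
    rw [opProd_smul, polyMul_smul_right]
  unfold operatorProduct
  rw [subst_congr e _ (e ▸ h (c • w)), subst_smul c _ (h w), ← mul_smul_iter, ← mul_smul_iter]
  exact congrArg (fun z : LaurentSeries (LaurentSeries ℂ) =>
    z • subst (polyMul p (opProd ![a, b] w)) (h w)) (by ring)

open scoped Classical in
/-- `Y_E(a(x), x₀) b(x) w ∈ W((x))((x₀))` for a quasi compatible pair (and `0` otherwise). -/
def YE (a b : E W) (w : W) : IterLaurent W :=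
  if h : QuasiCompatible ![a, b] then
    operatorProduct ((quasiCompatible_pair_iff a b).1 h).choose a b
      ((quasiCompatible_pair_iff a b).1 h).choose_spec.2 w
  else 0

theorem YE_eq (p : MvPolynomial (Fin 2) ℂ) (hp : p ≠ 0) (a b : E W) (h : Clears p ![a, b])
    (w : W) : YE a b w = operatorProduct p a b h w := by
  have hc : QuasiCompatible ![a, b] := (quasiCompatible_pair_iff a b).2 ⟨p, hp, h⟩
  rw [YE, dif_pos hc]
  exact operatorProduct_eq _ _ ((quasiCompatible_pair_iff a b).1 hc).choose_spec.1 hp _ _ _ _ _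

/-- `a(x)_n b(x) ∈ E(W)`, the coefficient of `x₀ ^ (-n - 1)` in `Y_E(a(x), x₀) b(x)`, for a quasi
compatible pair (and `0` otherwise). -/
def nthProduct (a b : E W) (n : ℤ) : E W where
  toFun w := ((HahnModule.of (LaurentSeries ℂ)).symm (YE a b w)).coeff (-n - 1)
  map_add' v w := by
    by_cases h : QuasiCompatible ![a, b]
    · simp only [YE, dif_pos h, operatorProduct_add]
      rfl
    · simp only [YE, dif_neg h]
      exact (add_zero _).symm
  map_smul' c w := by
    by_cases h : QuasiCompatible ![a, b]
    · simp only [YE, dif_pos h, operatorProduct_smul]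
      refine HahnModule.ext _ _ (funext fun s => ?_)
      have := iterCoeff_single_smul c 0 0 (YE a b w) (-n - 1) s
      simp only [YE, dif_pos h, sub_zero] at this
      exact this
    · simp only [YE, dif_neg h]
      exact (smul_zero c).symm

end Products

section Algebras

/-- A subspace of `E(W)` is closed if it contains `a(x)_n b(x)` for all its members `a(x)`, `b(x)`
and all integers `n`. -/
def IsClosedSubspace {W : Type*} [AddCommGroup W] [Module ℂ W] (V : Submodule ℂ (E W)) : Prop :=
  ∀ a ∈ V, ∀ b ∈ V, ∀ n : ℤ, nthProduct a b n ∈ V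

/-- `A(x₀ + x₂) B(x₂) w`, with powers of `x₀ + x₂` expanded in nonnegative powers of `x₂`; index
`0` is the exponent of `x₀` and index `1` that of `x₂`. -/
def composeShifted {W : Type*} [AddCommGroup W] [Module ℂ W] (A B : E W) (w : W) :
    FormalSeries 2 W :=
  fun m => ∑ᶠ k : ℕ, Ring.choose (m 0 + k) k •
    HVertexOperator.coeff A (m 0 + k) (HVertexOperator.coeff B (m 1 - k) w)

/-- `Y_W(Y(u, x₀) v, x₂) w`, with the same indexing. -/
def iterateSeries {V W : Type*} [AddCommGroup V] [Module ℂ V] [AddCommGroup W] [Module ℂ W]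
    (Y : V →ₗ[ℂ] E V) (YW : V →ₗ[ℂ] E W) (u v : V) (w : W) : FormalSeries 2 W :=
  fun m => HVertexOperator.coeff (YW (HVertexOperator.coeff (Y u) (m 0) v)) (m 1) w

/-- `(V, Y, 𝟏)` is a nonlocal vertex algebra. -/
structure IsNonlocalVertexAlgebra {V : Type*} [AddCommGroup V] [Module ℂ V] (Y : V →ₗ[ℂ] E V)
    (one : V) : Prop where
  vacuum : Y one = idSeries V
  creation_regular : ∀ (v : V) (n : ℤ), n < 0 → HVertexOperator.coeff (Y v) n one = 0
  creation : ∀ v : V, HVertexOperator.coeff (Y v) 0 one = v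
  weak_assoc : ∀ u v w : V, ∃ l : ℕ,
    polyMul ((X 0 + X 1) ^ l) (composeShifted (Y u) (Y v) w) =
      polyMul ((X 0 + X 1) ^ l) (iterateSeries Y Y u v w)

/-- `(W, Y_W)` is a quasi module for the nonlocal vertex algebra `(V, Y, 𝟏)`. -/
structure IsQuasiModule {V W : Type*} [AddCommGroup V] [Module ℂ V] [AddCommGroup W] [Module ℂ W]
    (Y : V →ₗ[ℂ] E V) (one : V) (YW : V →ₗ[ℂ] E W) : Prop where
  vacuum : YW one = idSeries W
  quasi_assoc : ∀ (u v : V) (w : W), ∃ f : MvPolynomial (Fin 2) ℂ, f ≠ 0 ∧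
    polyMul (bind₁ ![X 0 + X 1, X 1] f) (composeShifted (YW u) (YW v) w) =
      polyMul (bind₁ ![X 0 + X 1, X 1] f) (iterateSeries Y YW u v w)

end Algebras

end QuasiVertex

end

noncomputable section

namespace QuasiVertex

open MvPolynomial

/-! ### The substitution `x₁ = x + x₀` as a relation between two-variable series. -/

section Substitution

variable {W : Type*} [AddCommGroup W] [Module ℂ W]

/-! The series `Y_E(a, x₀)b` applied to `w` is determined by the product `a(x₁)b(x)w`: multiplied by
`p(x + x₀, x)` it is the cleared product at `x₁ = x + x₀`, and `p(x + x₀, x)` is invertible in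
`ℂ((x))((x₀))`. `IsSubst` expresses this without fixing `p`, and `IsSubst.unique` turns it into a
characterization. Bilinearity, the vacuum and the creation property then follow by computing
substitutions.

For the quasi module axiom, `p(x₁, x₂)a(x₁)b(x₂)w` is multiplied by a power of `x₁` until no
negative power of `x₁` is left. Then `x₁ = x₀ + x₂` may be expanded in either direction with the
same result (`expandSeries_eq_substSeries`), which identifies the product with the iterate.

For weak associativity, `Y(a, x₀ + x₁)Y(b, x₁)c` and `Y(Y(a, x₀)b, x₁)c` are made to act on `w`
through `Y_W(·, x₂)`. Multiplied by `p(x₀ + x₁ + x₂, x₁ + x₂) p(x₀ + x₁ + x₂, x₂) p(x₁ + x₂, x₂)`,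
both become the cleared triple product evaluated at `(x₀ + x₁ + x₂, x₁ + x₂, x₂)`; the two orders of
substitution agree by `expand_subst_subst`. Writing `p = (x - y)^l q` with `q(x, x) ≠ 0`, the
multiplier is `x₀^l x₁^l (x₀ + x₁)^l Q` with `Q(0, 0, x₂) ≠ 0`.

The two sides lie in different spaces of iterated Laurent series, so `Q` cannot be cancelled at
once. But the common value has no negative powers of `x₀` or `x₁`, and
`IsNested.eq_zero_of_polyMul`, applied to each side in its own space, shows that `x₀^l x₁^l (x₀ +
x₁)^l` times either side has none. The difference then lies in a single space, where `Q` cancels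
(`exists_pow_mul_expand_eq`). The monomials cancel too and `(x₀ + x₁)^l` remains. Since `l` depends
on `p` alone and not on `w`, the identity descends to `V` by faithfulness. -/

theorem polyMul_X_apply {r : ℕ} (i : Fin r) (F : FormalSeries r W) (m : Fin r → ℤ) :
    polyMul (X i) F m = F (fun j => m j - if j = i then 1 else 0) := by
  have h := polyMul_mul_X 1 i F m
  rwa [one_mul, ← C_1, polyMul_C, one_smul] at h

theorem polyMul_comm {r : ℕ} (p q : MvPolynomial (Fin r) ℂ) (F : FormalSeries r W) :
    polyMul p (polyMul q F) = polyMul q (polyMul p F) := by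
  rw [← polyMul_mul, ← polyMul_mul, mul_comm]

theorem polyMul_sub_right {r : ℕ} (q : MvPolynomial (Fin r) ℂ) (F G : FormalSeries r W) :
    polyMul q (F - G) = polyMul q F - polyMul q G := by
  funext m; simp [polyMul, smul_sub]

theorem polyMul_map {r : ℕ} {U : Type*} [AddCommGroup U] [Module ℂ U] (f : W →ₗ[ℂ] U)
    (q : MvPolynomial (Fin r) ℂ) (F : FormalSeries r W) :
    polyMul q (fun m => f (F m)) = fun m => f (polyMul q F m) := by
  funext m; simp [polyMul]

/-- A relation between formal series which respects addition, scalars and the action of generators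
of a polynomial ring respects the action of all its elements. -/
theorem polyMul_rel {r r' : ℕ} {σ U : Type*} [AddCommGroup U] [Module ℂ U]
    {Rel : FormalSeries r W → FormalSeries r' U → Prop}
    (hadd : ∀ F F' G G', Rel F G → Rel F' G' → Rel (F + F') (G + G'))
    (hsmul : ∀ (c : ℂ) F G, Rel F G → Rel (c • F) (c • G))
    {g : σ → MvPolynomial (Fin r) ℂ} {h : σ → MvPolynomial (Fin r') ℂ}
    (hX : ∀ i F G, Rel F G → Rel (polyMul (g i) F) (polyMul (h i) G))
    (q : MvPolynomial σ ℂ) {F : FormalSeries r W} {G : FormalSeries r' U} (hFG : Rel F G) :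
    Rel (polyMul (bind₁ g q) F) (polyMul (bind₁ h q) G) := by
  induction q using MvPolynomial.induction_on generalizing F G with
  | C c =>
    rw [bind₁_C_right, bind₁_C_right, polyMul_C, polyMul_C]
    exact hsmul c _ _ hFG
  | add p q hp hq =>
    rw [map_add, map_add, polyMul_add, polyMul_add]
    exact hadd _ _ _ _ (hp hFG) (hq hFG)
  | mul_X p i hp =>
    rw [map_mul, map_mul, polyMul_mul, polyMul_mul, bind₁_X_right, bind₁_X_right]
    exact hp (hX _ _ _ hFG)

/-- The images of the variables under `x_u ↦ x_u + x_v`. -/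
def shiftVar {r : ℕ} (u v : Fin r) : Fin r → MvPolynomial (Fin r) ℂ :=
  Function.update X u (X u + X v)

/-- The two-variable slice of a series, in the variables `x_u` and `x_v`, through `m`. -/
def slice {r : ℕ} {U : Type*} (u v : Fin r) (F : FormalSeries r U) (m : Fin r → ℤ) :
    FormalSeries 2 U :=
  fun n => F (Function.update (Function.update m u (n 0)) v (n 1))

theorem slice_apply_self {r : ℕ} {U : Type*} (u v : Fin r) (F : FormalSeries r U)
    (m : Fin r → ℤ) : slice u v F m ![m u, m v] = F m := by
  simp [slice]

theorem slice_polyMul_X_left {r : ℕ} {u v : Fin r} (huv : u ≠ v) (F : FormalSeries r W)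
    (m : Fin r → ℤ) : slice u v (polyMul (X u) F) m = polyMul (X 0) (slice u v F m) := by
  funext n
  simp only [slice, polyMul_X_apply]
  congr 1
  funext j
  by_cases hv : j = v
  · subst hv; simp [huv.symm]
  · by_cases hu : j = u
    · subst hu; simp [huv]
    · simp [hu, hv]

theorem slice_polyMul_X_right {r : ℕ} {u v : Fin r} (huv : u ≠ v) (F : FormalSeries r W)
    (m : Fin r → ℤ) : slice u v (polyMul (X v) F) m = polyMul (X 1) (slice u v F m) := by
  funext n
  simp only [slice, polyMul_X_apply]
  congr 1
  funext j
  by_cases hv : j = v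
  · subst hv; simp
  · by_cases hu : j = u
    · subst hu; simp [huv]
    · simp [hu, hv]

theorem slice_polyMul_X_of_ne {r : ℕ} {u v i : Fin r} (hu : i ≠ u) (hv : i ≠ v)
    (F : FormalSeries r W) (m : Fin r → ℤ) : slice u v (polyMul (X i) F) m =
      slice u v F (fun j => m j - if j = i then 1 else 0) := by
  funext n
  simp only [slice, polyMul_X_apply]
  congr 1
  funext j
  by_cases hjv : j = v
  · subst hjv; simp [hv.symm]
  · by_cases hju : j = u
    · subst hju; simp [hu.symm, hjv]
    · simp [hju, hjv]

/-- A relation between two-variable series which is compatible with the polynomial substitution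
`x₀ ↦ x₀ + x₁`. -/
structure ShiftSemilinear {U : Type*} [AddCommGroup U] [Module ℂ U]
    (Rel : FormalSeries 2 W → FormalSeries 2 U → Prop) : Prop where
  add : ∀ F F' G G', Rel F G → Rel F' G' → Rel (F + F') (G + G')
  smul : ∀ (c : ℂ) F G, Rel F G → Rel (c • F) (c • G)
  X_zero : ∀ F G, Rel F G → Rel (polyMul (X 0) F) (polyMul (X 0 + X 1) G)
  X_one : ∀ F G, Rel F G → Rel (polyMul (X 1) F) (polyMul (X 1) G)

/-- A variable other than `x_u`, `x_v` only moves the base point of the slice, so closure under the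
two sliced variables is enough for polynomials in all `r` variables. -/
theorem ShiftSemilinear.slice_polyMul {r : ℕ} {Rel : FormalSeries 2 W → FormalSeries 2 W → Prop}
    (hRel : ShiftSemilinear Rel) {u v : Fin r} (huv : u ≠ v) {F G : FormalSeries r W}
    (h : ∀ m, Rel (slice u v F m) (slice u v G m)) (q : MvPolynomial (Fin r) ℂ) (m : Fin r → ℤ) :
    Rel (slice u v (polyMul q F) m) (slice u v (polyMul (bind₁ (shiftVar u v) q) G) m) := by
  have key := polyMul_rel (Rel := fun F G : FormalSeries r W =>
      ∀ m, Rel (slice u v F m) (slice u v G m)) (g := X) (h := shiftVar u v)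
    (fun F F' G G' h h' m => hRel.add _ _ _ _ (h m) (h' m))
    (fun c F G h m => hRel.smul c _ _ (h m)) (fun i F G h m => ?_) q h m
  · rwa [bind₁_X_left] at key
  · by_cases hu : i = u
    · subst hu
      rw [slice_polyMul_X_left huv, shiftVar, Function.update_self, polyMul_add]
      have e : slice i v (polyMul (X i) G + polyMul (X v) G) m =
          polyMul (X 0 + X 1) (slice i v G m) := by
        rw [polyMul_add, ← slice_polyMul_X_left huv, ← slice_polyMul_X_right huv]
        rfl
      rw [e]
      exact hRel.X_zero _ _ (h m)
    · rw [shiftVar, Function.update_of_ne hu]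
      by_cases hv : i = v
      · subst hv
        rw [slice_polyMul_X_right huv, slice_polyMul_X_right huv]
        exact hRel.X_one _ _ (h m)
      · rw [slice_polyMul_X_of_ne hu hv, slice_polyMul_X_of_ne hu hv]
        exact h _

theorem slice_zero_one {U : Type*} (F : FormalSeries 2 U) (m : Fin 2 → ℤ) : slice 0 1 F m = F := by
  funext n
  simp only [slice]
  congr 1
  funext j
  fin_cases j <;> simp

theorem ShiftSemilinear.polyMul {Rel : FormalSeries 2 W → FormalSeries 2 W → Prop}
    (hRel : ShiftSemilinear Rel) {F G : FormalSeries 2 W} (h : Rel F G)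
    (q : MvPolynomial (Fin 2) ℂ) :
    Rel (polyMul q F) (polyMul (bind₁ (shiftVar 0 1) q) G) := by
  have := hRel.slice_polyMul (F := F) (G := G) (u := 0) (v := 1) (by decide)
    (fun m => by simpa only [slice_zero_one] using h) q 0
  simpa only [slice_zero_one] using this

/-- The coefficients of an element of `W((x))((x₀))`; index `0` is the exponent of `x₀`. -/
def iterSeries (G : IterLaurent W) : FormalSeries 2 W := fun m => iterCoeff G (m 0) (m 1)

theorem iterSeries_injective : Function.Injective (iterSeries (W := W)) := fun G H h =>
  iterCoeff_ext fun n s => by simpa [iterSeries] using congrFun h ![n, s]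

/-- The condition for a series in `x₀, x` to lie in `W((x))((x₀))`. -/
def IsIterTruncated (y : FormalSeries 2 W) : Prop :=
  (∃ N : ℤ, ∀ m, y m ≠ 0 → N ≤ m 0) ∧ ∀ n : ℤ, ∃ N : ℤ, ∀ s, y ![n, s] ≠ 0 → N ≤ s

theorem isIterTruncated_iterSeries (G : IterLaurent W) : IsIterTruncated (iterSeries G) := by
  constructor
  · refine ⟨((HahnModule.of (LaurentSeries ℂ)).symm G).order, fun m hm => ?_⟩
    by_contra hlt
    apply hm
    simp only [iterSeries, iterCoeff]
    rw [HahnSeries.coeff_eq_zero_of_lt_order (not_le.mp hlt)]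
    rfl
  · intro n
    refine ⟨((HahnModule.of ℂ).symm (((HahnModule.of (LaurentSeries ℂ)).symm G).coeff n)).order,
      fun s hs => ?_⟩
    by_contra hlt
    exact hs (HahnSeries.coeff_eq_zero_of_lt_order (not_le.mp hlt))

/-- Allows passing from arrays of coefficients to vectors over the field `ℂ((x))((x₀))`, where `p(x
+ x₀, x)` can be inverted. -/
theorem exists_iterSeries_eq {y : FormalSeries 2 W} (hy : IsIterTruncated y) :
    ∃ G : IterLaurent W, iterSeries G = y := by
  obtain ⟨⟨N, hN⟩, h⟩ := hy
  have hb : ∀ n : ℤ, BddBelow (Function.support fun s : ℤ => y ![n, s]) := fun n =>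
    ⟨(h n).choose, fun s hs => (h n).choose_spec s hs⟩
  let f : ℤ → Laurent W := fun n => HahnModule.of ℂ (HahnSeries.ofSuppBddBelow _ (hb n))
  have hf : BddBelow (Function.support f) := by
    refine ⟨N, fun n hn => ?_⟩
    by_contra hlt
    refine hn (HahnModule.ext _ _ (funext fun s => ?_))
    by_contra hs
    exact hlt (hN ![n, s] hs)
  refine ⟨HahnModule.of (LaurentSeries ℂ) (HahnSeries.ofSuppBddBelow f hf), ?_⟩
  funext m
  change y ![m 0, m 1] = y m
  congr 1
  funext j
  fin_cases j <;> rfl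

theorem IsIterTruncated.add {y z : FormalSeries 2 W} (hy : IsIterTruncated y)
    (hz : IsIterTruncated z) : IsIterTruncated (y + z) := by
  obtain ⟨G, rfl⟩ := exists_iterSeries_eq hy
  obtain ⟨H, rfl⟩ := exists_iterSeries_eq hz
  exact isIterTruncated_iterSeries (G + H)

theorem iterSeries_shiftedPoly_smul (p : MvPolynomial (Fin 2) ℂ) (G : IterLaurent W) :
    iterSeries (shiftedPoly p • G) = polyMul (bind₁ (shiftVar 0 1) p) (iterSeries G) := by
  have hx (F : FormalSeries 2 W) (m : Fin 2 → ℤ) : polyMul (X 1) F m = F ![m 0, m 1 - 1] := by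
    rw [polyMul_X_apply]; congr 1; funext j; fin_cases j <;> simp
  have hx' (F : FormalSeries 2 W) (m : Fin 2 → ℤ) : polyMul (X 0) F m = F ![m 0 - 1, m 1] := by
    rw [polyMul_X_apply]; congr 1; funext j; fin_cases j <;> simp
  induction p using MvPolynomial.induction_on generalizing G with
  | C c =>
    rw [bind₁_C_right, polyMul_C, shiftedPoly_C]
    funext m
    simp [iterSeries, iterCoeff_single_smul]
  | add p q hp hq =>
    rw [map_add, polyMul_add, ← hp, ← hq,
      show shiftedPoly (p + q) = shiftedPoly p + shiftedPoly q from eval₂_add _ _, add_smul_iter]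
    rfl
  | mul_X p i hp =>
    rw [shiftedPoly_mul, mul_smul_iter, hp, map_mul, polyMul_mul, bind₁_X_right]
    congr 1
    funext m
    fin_cases i
    · simp only [Fin.zero_eta, shiftedPoly_X_zero, shiftVar, Function.update_self, polyMul_add,
        Pi.add_apply, hx, hx']
      have h1 := iterCoeff_single_smul 1 1 0 G (m 0) (m 1)
      have h2 := iterCoeff_single_smul 1 0 1 G (m 0) (m 1)
      rw [one_smul, sub_zero] at h1 h2
      simp only [iterSeries, add_smul_iter, iterCoeff_add]
      rw [add_comm]
      exact congrArg₂ (· + ·) h1 h2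
    · simp only [Fin.mk_one, shiftedPoly_X_one, shiftVar]
      rw [Function.update_of_ne (by decide), hx]
      simp [iterSeries, iterCoeff_single_smul]

theorem IsIterTruncated.polyMul_shift {y : FormalSeries 2 W} (hy : IsIterTruncated y)
    (p : MvPolynomial (Fin 2) ℂ) : IsIterTruncated (polyMul (bind₁ (shiftVar 0 1) p) y) := by
  obtain ⟨G, rfl⟩ := exists_iterSeries_eq hy
  rw [← iterSeries_shiftedPoly_smul]
  exact isIterTruncated_iterSeries _

theorem inv_smul_smul_iter {f : LaurentSeries (LaurentSeries ℂ)} (hf : f ≠ 0) (G : IterLaurent W) :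
    f⁻¹ • f • G = G := by
  have e : f⁻¹ * f = 1 := by field_simp
  refine (mul_smul_iter _ _ G).symm.trans
    ((congrArg (fun g : LaurentSeries (LaurentSeries ℂ) => g • G) e).trans ?_)
  refine iterCoeff_ext fun n s => ?_
  have := iterCoeff_single_smul 1 0 0 G n s
  rwa [one_smul, sub_zero, sub_zero] at this

/-- `p(x + x₀, x)` is a nonzero element of the field `ℂ((x))((x₀))`. Truncation is essential: on
unrestricted series `x + x₀` has a kernel. -/
theorem IsIterTruncated.polyMul_shift_cancel {y z : FormalSeries 2 W} (hy : IsIterTruncated y)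
    (hz : IsIterTruncated z) {p : MvPolynomial (Fin 2) ℂ} (hp : p ≠ 0)
    (h : polyMul (bind₁ (shiftVar 0 1) p) y = polyMul (bind₁ (shiftVar 0 1) p) z) : y = z := by
  obtain ⟨G, rfl⟩ := exists_iterSeries_eq hy
  obtain ⟨H, rfl⟩ := exists_iterSeries_eq hz
  rw [← iterSeries_shiftedPoly_smul, ← iterSeries_shiftedPoly_smul] at h
  have h' := congrArg (fun z : IterLaurent W => (shiftedPoly p)⁻¹ • z) (iterSeries_injective h)
  exact congrArg iterSeries (((inv_smul_smul_iter (shiftedPoly_ne_zero hp) G).symm.trans h').trans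
    (inv_smul_smul_iter (shiftedPoly_ne_zero hp) H))

/-- The coefficients of `F(x + x₀, x)`, expanded in nonnegative powers of `x₀`; index `0` is the
exponent of `x₀`. -/
def substSeries {U : Type*} [AddCommGroup U] (F : FormalSeries 2 U) : FormalSeries 2 U :=
  fun m => if 0 ≤ m 0 then substCoeff F (m 0).toNat (m 1) else 0

theorem iterSeries_subst {F : FormalSeries 2 W} (hF : IsLowerTruncated F) :
    iterSeries (subst F hF) = substSeries F :=
  funext fun _ => iterCoeff_subst F hF _ _

theorem substSeries_polyMul {F : FormalSeries 2 W} (hF : IsLowerTruncated F)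
    (p : MvPolynomial (Fin 2) ℂ) :
    substSeries (polyMul p F) = polyMul (bind₁ (shiftVar 0 1) p) (substSeries F) := by
  rw [← iterSeries_subst hF, ← iterSeries_subst (hF.polyMul p), subst_polyMul,
    iterSeries_shiftedPoly_smul]

theorem IsLowerTruncated.add {r : ℕ} {U : Type*} [AddCommGroup U] {F G : FormalSeries r U}
    (hF : IsLowerTruncated F) (hG : IsLowerTruncated G) : IsLowerTruncated (F + G) := by
  obtain ⟨N, hN⟩ := hF
  obtain ⟨M, hM⟩ := hG
  refine ⟨min N M, fun m hm i => ?_⟩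
  by_cases h : F m = 0
  · have h' : G m ≠ 0 := fun h' => hm (by simp [h, h'])
    exact (min_le_right _ _).trans (hM m h' i)
  · exact (min_le_left _ _).trans (hN m h i)

theorem IsLowerTruncated.map {r : ℕ} {U : Type*} [AddCommGroup U] [Module ℂ U] (f : W →ₗ[ℂ] U)
    {F : FormalSeries r W} (hF : IsLowerTruncated F) : IsLowerTruncated fun m => f (F m) := by
  obtain ⟨N, hN⟩ := hF
  exact ⟨N, fun m hm => hN m fun h => hm (by simp [h])⟩

theorem substSeries_add {F G : FormalSeries 2 W} (hF : IsLowerTruncated F)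
    (hG : IsLowerTruncated G) : substSeries (F + G) = substSeries F + substSeries G := by
  rw [← iterSeries_subst hF, ← iterSeries_subst hG, ← iterSeries_subst (hF.add hG),
    subst_add _ _ hF hG]
  rfl

theorem substSeries_map {U : Type*} [AddCommGroup U] [Module ℂ U] (f : W →ₗ[ℂ] U)
    {F : FormalSeries 2 W} (hF : IsLowerTruncated F) :
    substSeries (fun m => f (F m)) = fun m => f (substSeries F m) := by
  funext m
  simp only [substSeries]
  split_ifs
  · unfold substCoeff
    refine Eq.trans ?_ (f.toAddMonoidHom.map_finsum (substCoeff_finite hF _ _)).symm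
    exact finsum_congr fun i => (map_zsmul f.toAddMonoidHom _ _).symm
  · simp

/-- `y(x₀, x) ∈ W((x))((x₀))` is obtained from `H(x₁, x)` by the substitution `x₁ = x + x₀`, after
the denominators of `H` have been cleared. -/
def IsSubst (H y : FormalSeries 2 W) : Prop :=
  ∃ p : MvPolynomial (Fin 2) ℂ, p ≠ 0 ∧ IsLowerTruncated (polyMul p H) ∧ IsIterTruncated y ∧
    polyMul (bind₁ (shiftVar 0 1) p) y = substSeries (polyMul p H)

theorem IsSubst.polyMul {H y : FormalSeries 2 W} (h : IsSubst H y) (q : MvPolynomial (Fin 2) ℂ) :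
    IsSubst (polyMul q H) (polyMul (bind₁ (shiftVar 0 1) q) y) := by
  obtain ⟨p, hp, hH, hy, e⟩ := h
  refine ⟨p, hp, ?_, hy.polyMul_shift q, ?_⟩
  · rw [polyMul_comm]
    exact hH.polyMul q
  · rw [polyMul_comm, e, polyMul_comm p q, substSeries_polyMul hH]

theorem IsSubst.add {H y H' y' : FormalSeries 2 W} (h : IsSubst H y) (h' : IsSubst H' y') :
    IsSubst (H + H') (y + y') := by
  obtain ⟨p, hp, hH, hy, e⟩ := h
  obtain ⟨q, hq, hH', hy', e'⟩ := h'
  have h1 : IsLowerTruncated (QuasiVertex.polyMul (p * q) H) := by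
    rw [mul_comm, polyMul_mul]; exact hH.polyMul q
  have h2 : IsLowerTruncated (QuasiVertex.polyMul (p * q) H') := by
    rw [polyMul_mul]; exact hH'.polyMul p
  refine ⟨p * q, mul_ne_zero hp hq, ?_, hy.add hy', ?_⟩
  · rw [polyMul_add_right]
    exact h1.add h2
  · rw [polyMul_add_right, polyMul_add_right, substSeries_add h1 h2]
    congr 1
    · rw [mul_comm, map_mul, polyMul_mul, e, polyMul_mul, substSeries_polyMul hH]
    · rw [map_mul, polyMul_mul, e', polyMul_mul, substSeries_polyMul hH']

theorem shiftSemilinear_isSubst : ShiftSemilinear (IsSubst (W := W)) where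
  add _ _ _ _ h h' := h.add h'
  smul c F G h := by simpa only [bind₁_C_right, polyMul_C] using h.polyMul (C c)
  X_zero F G h := by simpa [shiftVar] using h.polyMul (X 0)
  X_one F G h := by simpa [shiftVar] using h.polyMul (X 1)

/-- The product of the two denominators clears both sides to the same series. Identities between
`n`-th products are proved by showing both sides to be substitutions in the same `H`. -/
theorem IsSubst.unique {H y z : FormalSeries 2 W} (h : IsSubst H y) (h' : IsSubst H z) : y = z := by
  obtain ⟨p, hp, hH, hy, e⟩ := h
  obtain ⟨q, hq, hH', hz, e'⟩ := h'
  refine hy.polyMul_shift_cancel hz (mul_ne_zero hp hq) ?_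
  rw [map_mul, polyMul_mul, polyMul_mul, polyMul_comm, e, e', ← substSeries_polyMul hH,
    ← substSeries_polyMul hH', polyMul_comm]

theorem isSubst_substSeries {H : FormalSeries 2 W} (hH : IsLowerTruncated H) :
    IsSubst H (substSeries H) :=
  ⟨1, one_ne_zero, hH.polyMul 1, iterSeries_subst hH ▸ isIterTruncated_iterSeries _,
    (substSeries_polyMul hH 1).symm⟩

theorem IsSubst.eq_substSeries {H y : FormalSeries 2 W} (h : IsSubst H y)
    (hH : IsLowerTruncated H) : y = substSeries H :=
  h.unique (isSubst_substSeries hH)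

/-- Used with `f` a coefficient of a third operator standing to the left of the product. -/
theorem IsSubst.map (f : W →ₗ[ℂ] W) {H y : FormalSeries 2 W} (h : IsSubst H y) :
    IsSubst (fun m => f (H m)) (fun m => f (y m)) := by
  obtain ⟨p, hp, hH, ⟨⟨N, hN⟩, hy⟩, e⟩ := h
  refine ⟨p, hp, ?_, ⟨⟨N, fun m hm => hN m fun h => hm (by simp [h])⟩, fun n => ?_⟩, ?_⟩
  · rw [polyMul_map]
    exact hH.map f
  · obtain ⟨M, hM⟩ := hy n
    exact ⟨M, fun s hs => hM s fun h => hs (by simp [h])⟩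
  · rw [polyMul_map, polyMul_map, e, substSeries_map f hH]

theorem isSubst_YE {a b : E W} (h : QuasiCompatible ![a, b]) (w : W) :
    IsSubst (opProd ![a, b] w) (iterSeries (YE a b w)) := by
  obtain ⟨p, hp, hc⟩ := (quasiCompatible_pair_iff a b).1 h
  refine ⟨p, hp, hc w, isIterTruncated_iterSeries _, ?_⟩
  rw [← iterSeries_shiftedPoly_smul, ← iterSeries_subst (hc w), YE_eq p hp a b hc, operatorProduct]
  have hf := shiftedPoly_ne_zero hp
  have e : shiftedPoly p * (shiftedPoly p)⁻¹ = (shiftedPoly p)⁻¹ * shiftedPoly p := by ring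
  refine congrArg iterSeries (Eq.trans ?_ (inv_smul_smul_iter hf _))
  rw [← mul_smul_iter, ← mul_smul_iter]
  exact congrArg (fun g : LaurentSeries (LaurentSeries ℂ) => g • subst _ (hc w)) e

end Substitution

/-! ### Expansion in the opposite direction, and iterated substitutions in three variables. -/

section Expansion

variable {W : Type*} [AddCommGroup W] [Module ℂ W]

/-- `F(x₀ + x₂, x₂)`, with powers of `x₀ + x₂` expanded in nonnegative powers of `x₂`. -/
def expandSeries {U : Type*} [AddCommGroup U] (F : FormalSeries 2 U) : FormalSeries 2 U :=
  fun m => ∑ᶠ k : ℕ, Ring.choose (m 0 + k) k • F ![m 0 + k, m 1 - k]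

theorem composeShifted_eq (A B : E W) (w : W) :
    composeShifted A B w = expandSeries (opProd ![A, B] w) := by
  funext m
  simp [composeShifted, expandSeries, opProd]

theorem expandSeries_eq_sum {U : Type*} [AddCommGroup U] {F : FormalSeries 2 U} {N : ℤ}
    (hN : ∀ m, F m ≠ 0 → N ≤ m 1) (m : Fin 2 → ℤ) {K : ℕ} (hK : m 1 - K < N) :
    expandSeries F m = ∑ k ∈ Finset.range K, Ring.choose (m 0 + k) k • F ![m 0 + k, m 1 - k] := by
  refine finsum_eq_sum_of_support_subset _ fun k hk => ?_
  have h : F ![m 0 + k, m 1 - k] ≠ 0 := fun h => hk (by simp [h])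
  have := hN _ h
  simp at this
  simp
  omega

/-- `G(x₀, x₂) = F(x₀ + x₂, x₂)` for a series `F` with finitely many negative powers of its second
variable. -/
def IsExpansion (F G : FormalSeries 2 W) : Prop :=
  (∃ N : ℤ, ∀ m, F m ≠ 0 → N ≤ m 1) ∧ G = expandSeries F

theorem shiftSemilinear_isExpansion : ShiftSemilinear (IsExpansion (W := W)) where
  add := by
    rintro F F' _ _ ⟨⟨N, hN⟩, rfl⟩ ⟨⟨N', hN'⟩, rfl⟩
    have h : ∀ m, (F + F') m ≠ 0 → min N N' ≤ m 1 := fun m hm => by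
      by_cases h : F m = 0
      · exact (min_le_right _ _).trans (hN' m fun h' => hm (by simp [h, h']))
      · exact (min_le_left _ _).trans (hN m h)
    refine ⟨⟨_, h⟩, funext fun m => ?_⟩
    obtain ⟨K, hK⟩ : ∃ K : ℕ, m 1 - K < min N N' := ⟨(m 1 - min N N' + 1).toNat, by omega⟩
    rw [Pi.add_apply, expandSeries_eq_sum h m hK, expandSeries_eq_sum hN m (K := K) (by omega),
      expandSeries_eq_sum hN' m (K := K) (by omega), ← Finset.sum_add_distrib]
    simp
  smul := by
    rintro c F _ ⟨⟨N, hN⟩, rfl⟩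
    have h : ∀ m, (c • F) m ≠ 0 → N ≤ m 1 := fun m hm => hN m fun h => hm (by simp [h])
    refine ⟨⟨N, h⟩, funext fun m => ?_⟩
    have hK : m 1 - ((m 1 - N + 1).toNat : ℤ) < N := by omega
    rw [Pi.smul_apply, expandSeries_eq_sum h m hK, expandSeries_eq_sum hN m hK, Finset.smul_sum]
    simp only [Pi.smul_apply]
    exact Finset.sum_congr rfl fun k _ => smul_comm _ _ _
  X_zero := by
    rintro F _ ⟨⟨N, hN⟩, rfl⟩
    have h : ∀ m, polyMul (X 0) F m ≠ 0 → N ≤ m 1 := fun m hm => by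
      rw [polyMul_X_apply] at hm
      simpa using hN _ hm
    refine ⟨⟨N, h⟩, funext fun m => ?_⟩
    obtain ⟨i, j, rfl⟩ : ∃ i j, m = ![i, j] := ⟨m 0, m 1, by funext k; fin_cases k <;> rfl⟩
    obtain ⟨K, hK⟩ : ∃ K : ℕ, j - K < N := ⟨(j - N + 1).toNat, by omega⟩
    -- Pascal's rule. The `X 1` term is summed over one index fewer, so that its `k`-th summand
    -- meets the `(k + 1)`-st summands of the other two sums; the leftover summands for `k = 0`
    -- agree.
    rw [polyMul_add, Pi.add_apply, polyMul_X_zero_two, polyMul_X_one_two,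
      expandSeries_eq_sum h (K := K + 1) _ (by simp; omega),
      expandSeries_eq_sum hN (K := K + 1) ![i - 1, j] (by simp; omega),
      expandSeries_eq_sum hN (K := K) ![i, j - 1] (by simp; omega), Finset.sum_range_succ' _ K,
      Finset.sum_range_succ' _ K, add_right_comm,
      ← Finset.sum_add_distrib]
    simp only [Matrix.cons_val_zero, Matrix.cons_val_one, polyMul_X_zero_two]
    congr 1
    · refine Finset.sum_congr rfl fun k _ => ?_
      have e : i + ((k + 1 : ℕ) : ℤ) = i + k + 1 := by push_cast; ring
      have e' : i - 1 + ((k + 1 : ℕ) : ℤ) = i + k := by push_cast; ring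
      have e'' : j - ((k + 1 : ℕ) : ℤ) = j - 1 - k := by push_cast; ring
      rw [e, e', e'', Ring.choose_succ_succ, add_sub_cancel_right, ← add_smul, add_comm]
    · simp
  X_one := by
    rintro F _ ⟨⟨N, hN⟩, rfl⟩
    refine ⟨⟨N + 1, fun m hm => ?_⟩, funext fun m => ?_⟩
    · rw [polyMul_X_apply] at hm
      have := hN _ hm
      simp at this
      omega
    · obtain ⟨i, j, rfl⟩ : ∃ i j, m = ![i, j] := ⟨m 0, m 1, by funext k; fin_cases k <;> rfl⟩
      rw [polyMul_X_one_two]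
      refine finsum_congr fun k => ?_
      simp only [Matrix.cons_val_zero, Matrix.cons_val_one, polyMul_X_one_two]
      rw [sub_right_comm]

theorem substSeries_eq_sum {U : Type*} [AddCommGroup U] {F : FormalSeries 2 U} {m : Fin 2 → ℤ}
    (hm : 0 ≤ m 0) (S : Finset ℤ) (hS : ∀ i, i ∉ S → F ![i, m 1 + m 0 - i] = 0) :
    substSeries F m = ∑ i ∈ S, Ring.choose i (m 0).toNat • F ![i, m 1 + m 0 - i] := by
  rw [substSeries, if_pos hm, substCoeff, Int.toNat_of_nonneg hm]
  refine finsum_eq_sum_of_support_subset _ fun i hi => ?_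
  by_contra h
  exact hi (by simp only [hS i h, smul_zero])

theorem choose_eq_zero_of_lt {i : ℤ} {k : ℕ} (h0 : 0 ≤ i) (hk : i < k) : Ring.choose i k = 0 := by
  lift i to ℕ using h0
  rw [Ring.choose_natCast, Nat.choose_eq_zero_of_lt (by exact_mod_cast hk)]
  rfl

/-- Nonnegative powers of a sum of two variables are polynomials, so the direction of expansion is
irrelevant; on coefficients this is the symmetry of binomial coefficients. -/
theorem expandSeries_eq_substSeries {U : Type*} [AddCommGroup U] {F : FormalSeries 2 U} {N : ℤ}
    (h0 : ∀ m, F m ≠ 0 → 0 ≤ m 0) (hN : ∀ m, F m ≠ 0 → N ≤ m 1) :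
    expandSeries F = substSeries F := by
  funext m
  obtain ⟨i, j, rfl⟩ : ∃ i j, m = ![i, j] := ⟨m 0, m 1, by funext k; fin_cases k <;> rfl⟩
  by_cases hi : 0 ≤ i
  · lift i to ℕ using hi
    obtain ⟨K, hK⟩ : ∃ K : ℕ, j - K < N := ⟨(j - N + 1).toNat, by omega⟩
    have h1 : Function.Injective fun k : ℕ => (i : ℤ) + k := fun k k' h => by simpa using h
    rw [expandSeries_eq_sum hN (K := K) ![(i : ℤ), j] (by simpa using hK)]
    have h2 : substSeries F ![(i : ℤ), j] = ∑ l ∈ (Finset.range K).map ⟨_, h1⟩,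
        Ring.choose l i • F ![l, j + i - l] := by
      rw [substSeries, if_pos (by simp), substCoeff]
      refine finsum_eq_sum_of_support_subset _ fun l hl => ?_
      have hF : F ![l, j + i - l] ≠ 0 := fun h => hl (by simp [h])
      have hc : Ring.choose l i ≠ 0 := fun h => hl (by simp [h])
      have b0 := h0 _ hF
      have b1 := hN _ hF
      simp at b0 b1
      have b2 : (i : ℤ) ≤ l := by
        by_contra h
        exact hc (choose_eq_zero_of_lt b0 (by omega))
      simp only [Finset.coe_map, Function.Embedding.coeFn_mk, Set.mem_image, Finset.mem_coe,
        Finset.mem_range]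
      exact ⟨(l - i).toNat, by omega, by omega⟩
    rw [h2, Finset.sum_map]
    refine Finset.sum_congr rfl fun k _ => ?_
    simp only [Matrix.cons_val_zero, Matrix.cons_val_one, Function.Embedding.coeFn_mk]
    have e : j + i - ((i : ℤ) + k) = j - k := by ring
    have e' : (i : ℤ) + k = ((i + k : ℕ) : ℤ) := by push_cast; ring
    rw [e, e', Ring.choose_natCast, Ring.choose_natCast, Nat.choose_symm_add]
  · rw [substSeries, if_neg (by simpa using hi)]
    refine finsum_eq_zero_of_forall_eq_zero fun k => ?_
    simp only [Matrix.cons_val_zero, Matrix.cons_val_one]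
    by_cases h : F ![i + k, j - k] = 0
    · rw [h, smul_zero]
    · have := h0 _ h
      simp at this
      rw [choose_eq_zero_of_lt this (by omega), zero_smul]

/-- The operation `Φ` on two-variable series, applied in the variables `x_u` and `x_v`. -/
def alongSlices {r : ℕ} {U : Type*} (Φ : FormalSeries 2 U → FormalSeries 2 U) (u v : Fin r)
    (F : FormalSeries r U) : FormalSeries r U :=
  fun m => Φ (slice u v F m) ![m u, m v]

theorem eq_alongSlices {r : ℕ} {U : Type*} {Φ : FormalSeries 2 U → FormalSeries 2 U} {u v : Fin r}
    {F G : FormalSeries r U} (h : ∀ m, slice u v G m = Φ (slice u v F m)) :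
    G = alongSlices Φ u v F :=
  funext fun m => by rw [alongSlices, ← h, slice_apply_self]

theorem slice_alongSlices {r : ℕ} {U : Type*} (Φ : FormalSeries 2 U → FormalSeries 2 U)
    {u v : Fin r} (huv : u ≠ v) (F : FormalSeries r U) (m : Fin r → ℤ) :
    slice u v (alongSlices Φ u v F) m = Φ (slice u v F m) := by
  funext n
  have e : slice u v F (Function.update (Function.update m u (n 0)) v (n 1)) = slice u v F m := by
    funext n'
    simp only [slice]
    congr 1
    funext j
    by_cases hv : j = v
    · simp [hv]
    · by_cases hu : j = u
      · subst hu; simp [hv]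
      · simp [hu, hv]
  change Φ (slice u v F _) ![_, _] = _
  rw [e]
  congr 1
  funext j
  fin_cases j
  · simp [huv]
  · simp

theorem slice_zero_one_three {U : Type*} (F : FormalSeries 3 U) (m : Fin 3 → ℤ) :
    slice 0 1 F m = fun n => F ![n 0, n 1, m 2] := by
  funext n; simp only [slice]; congr 1; funext j; fin_cases j <;> simp [Function.update]

theorem slice_zero_two_three {U : Type*} (F : FormalSeries 3 U) (m : Fin 3 → ℤ) :
    slice 0 2 F m = fun n => F ![n 0, m 1, n 1] := by
  funext n; simp only [slice]; congr 1; funext j; fin_cases j <;> simp [Function.update]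

theorem slice_one_two_three {U : Type*} (F : FormalSeries 3 U) (m : Fin 3 → ℤ) :
    slice 1 2 F m = fun n => F ![m 0, n 0, n 1] := by
  funext n; simp only [slice]; congr 1; funext j; fin_cases j <;> simp [Function.update]

theorem IsLowerTruncated.slice {r : ℕ} {U : Type*} [AddCommGroup U] {F : FormalSeries r U}
    (hF : IsLowerTruncated F) {u v : Fin r} (huv : u ≠ v) (m : Fin r → ℤ) :
    IsLowerTruncated (slice u v F m) := by
  obtain ⟨N, hN⟩ := hF
  refine ⟨N, fun n hn i => ?_⟩
  have hu := hN _ hn u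
  have hv := hN _ hn v
  fin_cases i
  · simpa [huv] using hu
  · simpa using hv

/-- Since `choose (n + i) i * choose a (n + i) = choose a n * choose (a - n) i`, the sum reduces to
Vandermonde's identity for `(a - n) + b`. It compares the coefficients of the two iterated
substitutions below. -/
theorem sum_choose_mul_choose (a b : ℤ) (n k : ℕ) :
    ∑ i ∈ Finset.range (k + 1),
        Ring.choose ((n : ℤ) + i) i * (Ring.choose a (n + i) * Ring.choose b (k - i)) =
      Ring.choose a n * Ring.choose (a + b - n) k := by
  rw [show a + b - n = a - n + b by ring, Ring.add_choose_eq k (Commute.all _ _),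
    Finset.Nat.sum_antidiagonal_eq_sum_range_succ_mk, Finset.mul_sum]
  refine Finset.sum_congr rfl fun i _ => ?_
  have h := Ring.choose_smul_choose a (Nat.le_add_right n i)
  rw [Nat.add_sub_cancel_left, nsmul_eq_mul] at h
  rw [show (n : ℤ) + i = ((n + i : ℕ) : ℤ) by push_cast; ring, Ring.choose_natCast,
    ← Nat.choose_symm_add, ← mul_assoc, ← mul_assoc, ← h]

/-- Substitution preserves total degree, so the three exponents in `F` are at least `N` and add up
to `n + k + s`; hence each is at most `n + k + s - 2 * N`. Having the same box here and in the next
lemma permits a termwise comparison. -/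
theorem alongSlices_subst_zero_two_apply {U : Type*} [AddCommGroup U] {F : FormalSeries 3 U}
    {N : ℤ} (hN : ∀ m, F m ≠ 0 → ∀ i, N ≤ m i) (n k : ℕ) (s : ℤ) :
    alongSlices substSeries 0 2 (alongSlices substSeries 1 2 F) ![(n : ℤ), k, s] =
      ∑ a ∈ Finset.Icc N (n + k + s - 2 * N), ∑ b ∈ Finset.Icc N (n + k + s - 2 * N),
        (Ring.choose a n * Ring.choose b k) • F ![a, b, n + k + s - a - b] := by
  have hin (a t : ℤ) (S : Finset ℤ) (hS : ∀ i, i ∉ S → F ![a, i, t + k - i] = 0) :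
      alongSlices substSeries 1 2 F ![a, k, t] =
        ∑ b ∈ S, Ring.choose b k • F ![a, b, t + k - b] := by
    rw [alongSlices, slice_one_two_three, substSeries_eq_sum (by simp) S (by simpa using hS)]
    simp
  rw [alongSlices, slice_zero_two_three, substSeries_eq_sum (by simp)
    (Finset.Icc N (n + k + s - 2 * N)) ?_]
  · refine Finset.sum_congr rfl fun a ha => ?_
    simp only [Matrix.cons_val, Int.toNat_natCast]
    rw [hin _ _ (Finset.Icc N (n + k + s - 2 * N)), Finset.smul_sum]
    · refine Finset.sum_congr rfl fun b _ => ?_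
      rw [mul_smul, show s + (n : ℤ) - a + k - b = n + k + s - a - b by ring]
    · intro i hi
      by_contra h
      have h1 := hN _ h 1
      have h2 := hN _ h 2
      simp at h1 h2 hi ha
      omega
  · intro a ha
    simp only [Matrix.cons_val]
    rw [hin _ _ ∅, Finset.sum_empty]
    intro i _
    by_contra h
    have h0 := hN _ h 0
    have h1 := hN _ h 1
    have h2 := hN _ h 2
    simp at h0 h1 h2 ha
    omega

theorem alongSlices_subst_one_two_apply {U : Type*} [AddCommGroup U] {F : FormalSeries 3 U}
    {N : ℤ} (hN : ∀ m, F m ≠ 0 → ∀ i, N ≤ m i) (n k : ℕ) (s : ℤ) :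
    alongSlices substSeries 1 2 (alongSlices substSeries 0 1 F) ![(n : ℤ), k, s] =
      ∑ a ∈ Finset.Icc N (n + k + s - 2 * N), ∑ b ∈ Finset.Icc N (n + k + s - 2 * N),
        (Ring.choose a n * Ring.choose (a + b - n) k) • F ![a, b, n + k + s - a - b] := by
  set I := Finset.Icc N (n + k + s - 2 * N) with hI
  have hin (b t : ℤ) (S : Finset ℤ) (hS : ∀ i, i ∉ S → F ![i, b + n - i, t] = 0) :
      alongSlices substSeries 0 1 F ![n, b, t] =
        ∑ a ∈ S, Ring.choose a n • F ![a, b + n - a, t] := by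
    rw [alongSlices, slice_zero_one_three, substSeries_eq_sum (by simp) S (by simpa using hS)]
    simp
  rw [alongSlices, slice_one_two_three, substSeries_eq_sum (by simp)
    (Finset.Icc (2 * N - n) (k + s - N)) ?_]
  · have h1 : ∀ b ∈ Finset.Icc (2 * N - n) (k + s - N), alongSlices substSeries 0 1 F
        ![(n : ℤ), b, s + k - b] = ∑ a ∈ I, Ring.choose a n • F ![a, b + n - a, s + k - b] := by
      intro b hb
      refine hin _ _ I fun i hi => ?_
      by_contra h
      have h0 := hN _ h 0
      have h1 := hN _ h 1
      have h2 := hN _ h 2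
      simp [hI] at h0 h1 h2 hi
      omega
    simp only [Matrix.cons_val, Int.toNat_natCast]
    rw [Finset.sum_congr rfl fun b hb => by rw [h1 b hb, Finset.smul_sum], Finset.sum_comm]
    refine Finset.sum_congr rfl fun a ha => ?_
    -- After the first substitution the middle exponent is `a + b - n` instead of `b`; the sum is
    -- reindexed accordingly. The shifted box and the interval differ, but both contain the support.
    have h2 : ∑ b ∈ I, (Ring.choose a n * Ring.choose (a + b - n) k) •
        F ![a, b, n + k + s - a - b] = ∑ b ∈ I.map (Equiv.addRight (a - n : ℤ)).toEmbedding,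
          Ring.choose b k • Ring.choose a n • F ![a, b + n - a, s + k - b] := by
      rw [Finset.sum_map]
      refine Finset.sum_congr rfl fun b _ => ?_
      simp only [Equiv.toEmbedding_apply, Equiv.coe_addRight]
      rw [mul_comm, mul_smul, show b + (a - n) + n - a = b by ring,
        show s + k - (b + (a - n)) = n + k + s - a - b by ring,
        show b + (a - n) = a + b - n by ring]
    rw [h2]
    rw [← finsum_eq_sum_of_support_subset, ← finsum_eq_sum_of_support_subset]
    · intro b hb
      have h : F ![a, b + n - a, s + k - b] ≠ 0 := fun h => hb (by simp [h])
      have h0 := hN _ h 0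
      have h1 := hN _ h 1
      have h2 := hN _ h 2
      simp at h0 h1 h2
      simp [hI] at ha ⊢
      omega
    · intro b hb
      have h : F ![a, b + n - a, s + k - b] ≠ 0 := fun h => hb (by simp [h])
      have h0 := hN _ h 0
      have h1 := hN _ h 1
      have h2 := hN _ h 2
      simp at h0 h1 h2
      simp
      omega
  · intro b hb
    simp only [Matrix.cons_val]
    rw [hin _ _ ∅, Finset.sum_empty]
    intro i _
    by_contra h
    have h0 := hN _ h 0
    have h1 := hN _ h 1
    have h2 := hN _ h 2
    simp at h0 h1 h2 hb
    omega

theorem alongSlices_subst_eq_zero {U : Type*} [AddCommGroup U] {r : ℕ} (F : FormalSeries r U)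
    {u v : Fin r} {m : Fin r → ℤ} (h : m u < 0) : alongSlices substSeries u v F m = 0 := by
  rw [alongSlices, substSeries, if_neg (by simpa using h)]

theorem alongSlices_subst_subst_nonneg {U : Type*} [AddCommGroup U] (F : FormalSeries 3 U)
    {m : Fin 3 → ℤ} (h : alongSlices substSeries 0 2 (alongSlices substSeries 1 2 F) m ≠ 0) :
    0 ≤ m 0 ∧ 0 ≤ m 1 := by
  constructor
  · by_contra h0
    exact h (alongSlices_subst_eq_zero _ (not_le.mp h0))
  · by_contra h1
    refine h ?_
    rw [alongSlices, slice_zero_two_three, substSeries]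
    split_ifs
    · refine finsum_eq_zero_of_forall_eq_zero fun i => ?_
      exact (congrArg _ (alongSlices_subst_eq_zero F (by simpa using h1))).trans (smul_zero _)
    · rfl

/-- `F(x + x₁, x + x₂, x)`, followed by the substitution `x₁ = x₀ + x₂`, agrees with
`F(y + x₀, y, x)`, followed by the substitution `y = x + x₂`. -/
theorem expand_subst_subst {U : Type*} [AddCommGroup U] {F : FormalSeries 3 U} (hF : IsLowerTruncated F) :
    alongSlices expandSeries 0 1
        (alongSlices substSeries 0 2 (alongSlices substSeries 1 2 F)) =
      alongSlices substSeries 1 2 (alongSlices substSeries 0 1 F) := by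
  obtain ⟨N, hN⟩ := hF
  set T := alongSlices substSeries 0 2 (alongSlices substSeries 1 2 F) with hT
  have hT0 : ∀ m, T m ≠ 0 → 0 ≤ m 0 ∧ 0 ≤ m 1 := fun m => alongSlices_subst_subst_nonneg F
  funext m
  obtain ⟨n, k, s, rfl⟩ : ∃ n k s, m = ![n, k, s] :=
    ⟨m 0, m 1, m 2, by funext k; fin_cases k <;> rfl⟩
  rw [alongSlices, slice_zero_one_three]
  change expandSeries (fun l => T ![l 0, l 1, s]) ![n, k] = _
  have hs : ∀ l : Fin 2 → ℤ, T ![l 0, l 1, s] ≠ 0 → 0 ≤ l 1 := fun l hl => (hT0 _ hl).2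
  by_cases hk : 0 ≤ k
  · lift k to ℕ using hk
    -- `T` has no negative powers of `x₁`, so only the indices up to `k` contribute.
    rw [expandSeries_eq_sum (N := 0) hs (K := k + 1) ![n, k] (by simp)]
    simp only [Matrix.cons_val]
    by_cases hn : 0 ≤ n
    · lift n to ℕ using hn
      have h1 : ∀ i ∈ Finset.range (k + 1), T ![(n : ℤ) + i, k - i, s] =
          ∑ a ∈ Finset.Icc N (n + k + s - 2 * N), ∑ b ∈ Finset.Icc N (n + k + s - 2 * N),
            (Ring.choose a (n + i) * Ring.choose b (k - i)) • F ![a, b, n + k + s - a - b] := by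
        intro i hi
        rw [Finset.mem_range] at hi
        have := alongSlices_subst_zero_two_apply hN (n + i) (k - i) s
        rw [← hT, Nat.cast_sub (by omega), Nat.cast_add,
          show (n : ℤ) + i + (k - i) + s = n + k + s by ring] at this
        exact this
      rw [Finset.sum_congr rfl fun i hi => by rw [h1 i hi, Finset.smul_sum],
        alongSlices_subst_one_two_apply hN, Finset.sum_comm]
      refine Finset.sum_congr rfl fun a _ => ?_
      simp only [Finset.smul_sum]
      rw [Finset.sum_comm]
      refine Finset.sum_congr rfl fun b _ => ?_
      rw [← sum_choose_mul_choose, Finset.sum_smul]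
      simp only [mul_smul]
    · have e : alongSlices substSeries 1 2 (alongSlices substSeries 0 1 F) ![n, k, s] = 0 := by
        rw [alongSlices, slice_one_two_three, substSeries]
        split_ifs
        · refine finsum_eq_zero_of_forall_eq_zero fun i => ?_
          exact (congrArg _ (alongSlices_subst_eq_zero F (by simpa using hn))).trans (smul_zero _)
        · rfl
      rw [e]
      refine Finset.sum_eq_zero fun i _ => ?_
      -- A nonzero coefficient has `0 ≤ n + i`, while `n < 0` gives `n + i < i`, so the binomial
      -- coefficient vanishes.
      by_cases h : T ![n + i, k - i, s] = 0
      · rw [h, smul_zero]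
      · have := (hT0 _ h).1
        simp at this
        rw [choose_eq_zero_of_lt this (by omega), zero_smul]
  · rw [alongSlices_subst_eq_zero _ (by simpa using hk),
      expandSeries_eq_sum (N := 0) hs (K := 0) ![n, k] (by simpa using hk), Finset.sum_range_zero]

end Expansion

/-! ### Cancelling polynomials on iterated Laurent series in three variables. -/

section Cancellation

variable {W : Type*} [AddCommGroup W] [Module ℂ W]

theorem exists_uniform_lowerBound {ι : Type*} (s : Finset ι) {P : ι → ℤ → Prop}
    (h : ∀ i ∈ s, ∃ N, ∀ z, P i z → N ≤ z) : ∃ N, ∀ i ∈ s, ∀ z, P i z → N ≤ z := by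
  classical
  choose! N hN using h
  obtain ⟨M, hM⟩ := (s.image N).bddBelow
  exact ⟨M, fun i hi z hz => le_trans (hM (Finset.mem_coe.2 (Finset.mem_image_of_mem N hi))) (hN i hi z hz)⟩

/-- Truncation of a three-variable series `F` which lies in `U((x₂))((x_v))((x_u))` when
`{u, v} = {0, 1}`. -/
structure IsNested {U : Type*} [AddCommGroup U] (u v : Fin 3) (F : FormalSeries 3 U) : Prop where
  outer : ∃ N : ℤ, ∀ m, F m ≠ 0 → N ≤ m u
  middle : ∀ k : ℤ, ∃ N : ℤ, ∀ m, m u = k → F m ≠ 0 → N ≤ m v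
  inner : ∀ j k : ℤ, ∃ N : ℤ, ∀ s, F ![j, k, s] ≠ 0 → N ≤ s

theorem exists_of_polyMul_ne_zero {r : ℕ} {q : MvPolynomial (Fin r) ℂ} {F : FormalSeries r W}
    {m : Fin r → ℤ} (h : polyMul q F m ≠ 0) : ∃ d ∈ q.support, F (fun i => m i - (d i : ℤ)) ≠ 0 := by
  obtain ⟨d, hd, h⟩ := Finset.exists_ne_zero_of_sum_ne_zero h
  exact ⟨d, hd, fun h' => h (by rw [h', smul_zero])⟩

theorem IsNested.polyMul {u v : Fin 3} {F : FormalSeries 3 W} (hF : IsNested u v F)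
    (q : MvPolynomial (Fin 3) ℂ) : IsNested u v (polyMul q F) where
  outer := by
    obtain ⟨N, hN⟩ := hF.outer
    refine ⟨N, fun m hm => ?_⟩
    obtain ⟨d, -, hd⟩ := exists_of_polyMul_ne_zero hm
    have := hN _ hd
    omega
  middle k := by
    obtain ⟨N, hN⟩ := exists_uniform_lowerBound q.support
      (P := fun d z => ∃ m : Fin 3 → ℤ, m u = k - d u ∧ F m ≠ 0 ∧ m v = z) fun d _ => by
        obtain ⟨N, hN⟩ := hF.middle (k - d u)
        exact ⟨N, by rintro _ ⟨m, h1, h2, rfl⟩; exact hN m h1 h2⟩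
    refine ⟨N, fun m hk hm => ?_⟩
    obtain ⟨d, hd, h⟩ := exists_of_polyMul_ne_zero hm
    have := hN d hd _ ⟨_, by simp [hk], h, rfl⟩
    omega
  inner j k := by
    obtain ⟨N, hN⟩ := exists_uniform_lowerBound q.support
      (P := fun d z => F ![j - d 0, k - d 1, z] ≠ 0) fun d _ => hF.inner _ _
    refine ⟨N, fun s hs => ?_⟩
    obtain ⟨d, hd, h⟩ := exists_of_polyMul_ne_zero hs
    have e : (fun i => (![j, k, s] : Fin 3 → ℤ) i - (d i : ℤ)) =
        ![j - d 0, k - d 1, s - d 2] := by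
      funext i; fin_cases i <;> rfl
    rw [e] at h
    have := hN d hd _ h
    omega

/-- For a fixed exponent of `x₁` only finitely many terms of the binomial expansion contribute, so
their bounds can be made uniform. -/
theorem IsNested.expand {U : Type*} [AddCommGroup U] {F : FormalSeries 3 U} (hF : IsNested 1 0 F) :
    IsNested 1 0 (alongSlices expandSeries 0 1 F) := by
  obtain ⟨N, hN⟩ := hF.outer
  have key (m : Fin 3 → ℤ) (hm : alongSlices expandSeries 0 1 F m ≠ 0) :
      ∃ k ∈ Finset.range ((m 1 - N).toNat + 1), F ![m 0 + k, m 1 - k, m 2] ≠ 0 ∧ N ≤ m 1 := by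
    rw [alongSlices, slice_zero_one_three] at hm
    obtain ⟨k, hk⟩ : ∃ k : ℕ, F ![m 0 + k, m 1 - k, m 2] ≠ 0 := by
      by_contra! h
      exact hm (finsum_eq_zero_of_forall_eq_zero fun k =>
        (congrArg _ (h k)).trans (smul_zero _))
    have := hN _ hk
    simp at this
    exact ⟨k, by simp; omega, hk, by omega⟩
  refine ⟨⟨N, fun m hm => (key m hm).choose_spec.2.2⟩, fun l => ?_, fun j l => ?_⟩
  · obtain ⟨M, hM⟩ := exists_uniform_lowerBound (Finset.range ((l - N).toNat + 1))
      (P := fun k z => ∃ m : Fin 3 → ℤ, m 1 = l - k ∧ F m ≠ 0 ∧ m 0 - k = z) fun k _ => by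
        obtain ⟨M, hM⟩ := hF.middle (l - k)
        refine ⟨M - k, ?_⟩
        rintro _ ⟨m, h1, h2, rfl⟩
        have := hM m h1 h2
        omega
    refine ⟨M, fun m hl hm => ?_⟩
    obtain ⟨k, hk, h, -⟩ := key m hm
    rw [hl] at hk h
    exact hM k hk _ ⟨_, by simp, h, by simp⟩
  · obtain ⟨M, hM⟩ := exists_uniform_lowerBound (Finset.range ((l - N).toNat + 1))
      (P := fun k z => F ![j + k, l - k, z] ≠ 0) fun k _ => hF.inner _ _
    refine ⟨M, fun s hs => ?_⟩
    obtain ⟨k, hk, h, -⟩ := key _ hs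
    exact hM k hk _ h

/-- Minimizing the outer exponent and then the middle one gives a lexicographic minimum, which is
minimal for the product order as well. The conclusion does not refer to the order of nesting. -/
theorem IsNested.exists_minimal {U : Type*} [AddCommGroup U] {u v : Fin 3}
    (huv : u = 0 ∧ v = 1 ∨ u = 1 ∧ v = 0) {F : FormalSeries 3 U} (hF : IsNested u v F) {T : Set (ℤ × ℤ)}
    (hT : ∀ p ∈ T, ∃ s, F ![p.1, p.2, s] ≠ 0) (hne : T.Nonempty) :
    ∃ p ∈ T, ∀ q ∈ T, q ≤ p → q = p := by
  obtain ⟨N, hN⟩ := hF.outer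
  obtain ⟨p₀, hp₀⟩ := hne
  rcases huv with ⟨rfl, rfl⟩ | ⟨rfl, rfl⟩
  · obtain ⟨k, ⟨p₁, hp₁, rfl⟩, hk⟩ := Int.exists_least_of_bdd (P := fun z => ∃ p ∈ T, p.1 = z)
      ⟨N, by rintro _ ⟨p, hp, rfl⟩; obtain ⟨s, hs⟩ := hT p hp; exact hN _ hs⟩ ⟨_, p₀, hp₀, rfl⟩
    obtain ⟨M, hM⟩ := hF.middle p₁.1
    obtain ⟨j, ⟨p, hp, hp1, rfl⟩, hj⟩ := Int.exists_least_of_bdd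
      (P := fun z => ∃ p ∈ T, p.1 = p₁.1 ∧ p.2 = z)
      ⟨M, by rintro _ ⟨p, hp, h, rfl⟩; obtain ⟨s, hs⟩ := hT p hp; exact hM _ h hs⟩
      ⟨_, p₁, hp₁, rfl, rfl⟩
    refine ⟨p, hp, fun q hq hle => ?_⟩
    have h1 : q.1 = p.1 := le_antisymm hle.1 (hp1 ▸ hk _ ⟨q, hq, rfl⟩)
    exact Prod.ext h1 (le_antisymm hle.2 (hj _ ⟨q, hq, h1.trans hp1, rfl⟩))
  · obtain ⟨k, ⟨p₁, hp₁, rfl⟩, hk⟩ := Int.exists_least_of_bdd (P := fun z => ∃ p ∈ T, p.2 = z)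
      ⟨N, by rintro _ ⟨p, hp, rfl⟩; obtain ⟨s, hs⟩ := hT p hp; exact hN _ hs⟩ ⟨_, p₀, hp₀, rfl⟩
    obtain ⟨M, hM⟩ := hF.middle p₁.2
    obtain ⟨j, ⟨p, hp, hp1, rfl⟩, hj⟩ := Int.exists_least_of_bdd
      (P := fun z => ∃ p ∈ T, p.2 = p₁.2 ∧ p.1 = z)
      ⟨M, by rintro _ ⟨p, hp, h, rfl⟩; obtain ⟨s, hs⟩ := hT p hp; exact hM _ h hs⟩
      ⟨_, p₁, hp₁, rfl, rfl⟩
    refine ⟨p, hp, fun q hq hle => ?_⟩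
    have h1 : q.2 = p.2 := le_antisymm hle.2 (hp1 ▸ hk _ ⟨q, hq, rfl⟩)
    exact Prod.ext (le_antisymm hle.1 (hj _ ⟨q, hq, h1.trans hp1, rfl⟩)) h1

/-- If `q(0, 0, x₂) ≠ 0`, then multiplication by `q` reflects the vanishing of the coefficients of
a nested series on sets of exponents which are downwards closed in `x₀, x₁`. -/
theorem IsNested.eq_zero_of_polyMul {u v : Fin 3} (huv : u = 0 ∧ v = 1 ∨ u = 1 ∧ v = 0)
    {F : FormalSeries 3 W} (hF : IsNested u v F) {q : MvPolynomial (Fin 3) ℂ}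
    (hq : ∃ e, q.coeff (Finsupp.single 2 e) ≠ 0) {D : Set (ℤ × ℤ)} (hD : IsLowerSet D)
    (h : ∀ m, (m 0, m 1) ∈ D → QuasiVertex.polyMul q F m = 0) (m : Fin 3 → ℤ)
    (hm : (m 0, m 1) ∈ D) : F m = 0 := by
  classical
  by_contra hne
  have hvec (m : Fin 3 → ℤ) : ![m 0, m 1, m 2] = m := by funext i; fin_cases i <;> rfl
  -- A lowest term of `F` over `D`: `(j, k)` is minimal, and then `s` is least. As `D` is a lower
  -- set, `F` vanishes over every pair strictly below `(j, k)`.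
  obtain ⟨⟨j, k⟩, ⟨hjk, s₀, hs₀⟩, hmin⟩ := hF.exists_minimal huv
    (T := {p | p ∈ D ∧ ∃ s, F ![p.1, p.2, s] ≠ 0}) (fun p hp => hp.2)
    ⟨(m 0, m 1), hm, m 2, by simpa only [hvec] using hne⟩
  obtain ⟨s, hs, hsmin⟩ := Int.exists_least_of_bdd (P := fun s => F ![j, k, s] ≠ 0)
    (hF.inner j k) ⟨s₀, hs₀⟩
  have he := Nat.find_spec hq
  set e := Nat.find hq
  -- Only `x₂ ^ e` contributes: a monomial involving `x₀` or `x₁` reaches strictly below `(j, k)`, a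
  -- power of `x₂` above `e` reaches below `s`, and powers below `e` do not occur in `q` by the
  -- choice of `e`.
  have key : QuasiVertex.polyMul q F ![j, k, s + e] =
      q.coeff (Finsupp.single 2 e) • F ![j, k, s] := by
    rw [QuasiVertex.polyMul, Finset.sum_eq_single (Finsupp.single 2 e)]
    · congr 2
      funext i
      fin_cases i <;> simp
    · intro d hd hde
      by_contra hne
      have hF' : F ![j - d 0, k - d 1, s + e - d 2] ≠ 0 := by
        intro h0
        refine hne ?_
        rw [← hvec fun i => _ - _]
        simp only [Matrix.cons_val]
        rw [h0, smul_zero]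
      have hle : ((j - d 0, k - d 1) : ℤ × ℤ) ≤ (j, k) := ⟨by simp, by simp⟩
      have heq := hmin (j - d 0, k - d 1) ⟨hD hle hjk, _, hF'⟩ hle
      simp only [Prod.mk.injEq, sub_eq_self, Nat.cast_eq_zero] at heq
      rw [heq.1, heq.2] at hF'
      simp only [Nat.cast_zero, sub_zero] at hF'
      have h2 := hsmin _ hF'
      have hd' : d = Finsupp.single 2 (d 2) := by
        ext i; fin_cases i <;> simp [heq]
      have hlt : d 2 < e := lt_of_le_of_ne (by omega) fun h2 => hde (by rw [hd', h2])
      exact Nat.find_min hq hlt (by rw [← hd']; exact mem_support_iff.mp hd)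
    · intro hd
      rw [notMem_support_iff.mp hd, zero_smul]
  rw [h _ hjk] at key
  exact (smul_ne_zero he hs) key.symm

theorem polyMul_X_pow_eq_zero {r : ℕ} {i : Fin r} {l : ℕ} {F : FormalSeries r W}
    (h : polyMul (X i ^ l) F = 0) : F = 0 := by
  induction l with
  | zero => rwa [pow_zero, ← C_1, polyMul_C, one_smul] at h
  | succ l ih =>
    refine ih (funext fun m => ?_)
    rw [pow_succ', polyMul_mul] at h
    have := congrFun h fun j => m j + if j = i then 1 else 0
    rw [polyMul_X_apply] at this
    simpa using this

/-- Every nonzero polynomial is `(x₀ - x₁) ^ l q` with `q(x, x) ≠ 0`. -/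
theorem exists_eq_sub_pow_mul {p : MvPolynomial (Fin 2) ℂ} (hp : p ≠ 0) :
    ∃ (l : ℕ) (q : MvPolynomial (Fin 2) ℂ), p = (X 0 - X 1) ^ l * q ∧
      aeval (fun _ => (Polynomial.X : Polynomial ℂ)) q ≠ 0 := by
  -- Modulo `x₀ - x₁` every `q` equals `q(x₁, x₁)`. Dividing out the full multiplicity of `x₀ - x₁`
  -- therefore leaves a factor that is nonzero on the diagonal.
  have hdvd (q : MvPolynomial (Fin 2) ℂ) : (X 0 - X 1 : MvPolynomial (Fin 2) ℂ) ∣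
      q - Polynomial.aeval (X 1) (aeval (fun _ => (Polynomial.X : Polynomial ℂ)) q) := by
    induction q using MvPolynomial.induction_on with
    | C c => simp [algebraMap_eq]
    | add p q hp hq =>
      rw [map_add, map_add, add_sub_add_comm]
      exact dvd_add hp hq
    | mul_X p i hp =>
      rw [map_mul, map_mul, aeval_X, Polynomial.aeval_X]
      have h1 : (X 0 - X 1 : MvPolynomial (Fin 2) ℂ) ∣ X i - X 1 := by
        fin_cases i <;> simp
      have := dvd_add (hp.mul_right (X i)) (h1.mul_left
        (Polynomial.aeval (X 1) (aeval (fun _ => (Polynomial.X : Polynomial ℂ)) p)))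
      refine this.trans (dvd_of_eq ?_)
      ring
  have hnu : ¬ IsUnit (X 0 - X 1 : MvPolynomial (Fin 2) ℂ) := fun hu => by
    have := hu.map (aeval (fun _ => (0 : ℂ)) : MvPolynomial (Fin 2) ℂ →ₐ[ℂ] ℂ)
    simp at this
  obtain ⟨q, hq, hnd⟩ := (FiniteMultiplicity.of_not_isUnit hnu hp).exists_eq_pow_mul_and_not_dvd
  refine ⟨_, q, hq, fun h0 => hnd ?_⟩
  simpa [h0] using hdvd q

theorem exists_coeff_single_ne_zero {q : MvPolynomial (Fin 3) ℂ}
    (hq : aeval ![0, 0, (Polynomial.X : Polynomial ℂ)] q ≠ 0) :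
    ∃ e, q.coeff (Finsupp.single 2 e) ≠ 0 := by
  by_contra! h
  refine hq ?_
  rw [aeval_eq_eval₂Hom, coe_eval₂Hom, eval₂_eq']
  refine Finset.sum_eq_zero fun d hd => ?_
  have h01 : d 0 ≠ 0 ∨ d 1 ≠ 0 := by
    by_contra! h0
    refine mem_support_iff.mp hd ?_
    rw [← h (d 2)]
    congr 1
    ext i
    fin_cases i <;> simp [h0]
  rw [Fin.prod_univ_three]
  rcases h01 with h0 | h0 <;> simp [h0]

/-- The substitution `x₀ ↦ x₀ + x₁ + x₂`, `x₁ ↦ x₁ + x₂`, `x₂ ↦ x₂`. -/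
def shiftBoth : MvPolynomial (Fin 3) ℂ →ₐ[ℂ] MvPolynomial (Fin 3) ℂ :=
  aeval ![X 0 + X 1 + X 2, X 1 + X 2, X 2]

theorem pairwiseProd_three (p : MvPolynomial (Fin 2) ℂ) :
    pairwiseProd 3 p = rename ![0, 1] p * rename ![0, 2] p * rename ![1, 2] p := by
  have h0 : (Finset.Ioi (0 : Fin 3)) = {1, 2} := by decide
  have h1 : (Finset.Ioi (1 : Fin 3)) = {2} := by decide
  have h2 : (Finset.Ioi (2 : Fin 3)) = ∅ := by decide
  simp [pairwiseProd, Fin.prod_univ_three, h0, h1, h2]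

/-- The factorization of `p(x₀ + x₁ + x₂, x₁ + x₂) p(x₀ + x₁ + x₂, x₂) p(x₁ + x₂, x₂)` into powers
of `x₀`, `x₀ + x₁`, `x₁` and a factor which does not vanish at `x₀ = x₁ = 0`. -/
theorem exists_shiftBoth_pairwiseProd_eq {p : MvPolynomial (Fin 2) ℂ} (hp : p ≠ 0) :
    ∃ (l : ℕ) (q : MvPolynomial (Fin 3) ℂ), (∃ e, q.coeff (Finsupp.single 2 e) ≠ 0) ∧
      shiftBoth (pairwiseProd 3 p) = q * (X 0 ^ l * (X 1 ^ l * (X 0 + X 1) ^ l)) := by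
  obtain ⟨l, q, rfl, hq⟩ := exists_eq_sub_pow_mul hp
  refine ⟨l, shiftBoth (pairwiseProd 3 q), exists_coeff_single_ne_zero ?_, ?_⟩
  -- At `x₀ = x₁ = 0` all three shifted variables become `x₂`, so each factor restricts to `q(x₂,
  -- x₂)`.
  · have h (i j : Fin 3) : aeval ![0, 0, (Polynomial.X : Polynomial ℂ)]
        (shiftBoth (rename ![i, j] q)) = aeval (fun _ => (Polynomial.X : Polynomial ℂ)) q := by
      rw [← AlgHom.comp_apply, ← AlgHom.comp_apply]
      congr 1
      ext k
      fin_cases k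
      · fin_cases i <;> simp [shiftBoth]
      · fin_cases j <;> simp [shiftBoth]
    rw [pairwiseProd_three, map_mul, map_mul, map_mul, map_mul, h, h, h]
    exact mul_ne_zero (mul_ne_zero hq hq) hq
  -- The pairwise differences of the shifted variables are `x₀`, `x₀ + x₁` and `x₁`.
  · rw [pairwiseProd_three, pairwiseProd_three]
    simp only [map_mul, map_pow, map_sub, rename_X, shiftBoth, aeval_X, Matrix.cons_val_zero,
      Matrix.cons_val_one, Matrix.cons_val]
    ring

end Cancellation

/-! ### The map `Y_E`: truncation, bilinearity, vacuum and creation. -/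

section VertexMap

variable {W : Type*} [AddCommGroup W] [Module ℂ W]

theorem E.ext_coeff {a b : E W}
    (h : ∀ n w, HVertexOperator.coeff a n w = HVertexOperator.coeff b n w) : a = b :=
  HVertexOperator.coeff_inj (funext fun n => LinearMap.ext fun w => h n w)

theorem E.exists_lowerBound (a : E W) (w : W) :
    ∃ N : ℤ, ∀ n, HVertexOperator.coeff a n w ≠ 0 → N ≤ n :=
  ⟨_, fun n hn => by
    by_contra h
    exact hn (VertexOperator.coeff_eq_zero_of_lt_order a n w (not_le.mp h))⟩

theorem opProd_pair (a b : E W) (w : W) : opProd ![a, b] w = fun m =>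
    HVertexOperator.coeff a (m 0) (HVertexOperator.coeff b (m 1) w) := by
  funext m
  simp [opProd]

theorem opProd_triple (a b c : E W) (w : W) : opProd ![a, b, c] w = fun m =>
    HVertexOperator.coeff a (m 0) (HVertexOperator.coeff b (m 1)
      (HVertexOperator.coeff c (m 2) w)) := by
  funext m
  simp [opProd]

theorem coeff_nthProduct (a b : E W) (n s : ℤ) (w : W) :
    HVertexOperator.coeff (nthProduct a b (-n - 1)) s w = iterCoeff (YE a b w) n s := by
  have h : iterCoeff (YE a b w) (-(-n - 1) - 1) s = iterCoeff (YE a b w) n s := by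
    congr 1; ring
  exact h

theorem IsSubst.congr_left {H H' y : FormalSeries 2 W} (h : IsSubst H y) (hH : H' = H) :
    IsSubst H' y := hH ▸ h

theorem isSubst_nthProduct {a b : E W} (h : QuasiCompatible ![a, b]) (w : W) :
    IsSubst (fun m => HVertexOperator.coeff a (m 0) (HVertexOperator.coeff b (m 1) w))
      (fun m => HVertexOperator.coeff (nthProduct a b (-m 0 - 1)) (m 1) w) := by
  simp only [coeff_nthProduct]
  rw [← opProd_pair]
  exact isSubst_YE h w

theorem iterCoeff_smul_eq_zero {f : LaurentSeries (LaurentSeries ℂ)} {G : IterLaurent W}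
    (hG : ∀ n < 0, ((HahnModule.of (LaurentSeries ℂ)).symm G).coeff n = 0) {n : ℤ}
    (hn : n < f.order) (s : ℤ) : iterCoeff (f • G) n s = 0 := by
  have h : ((HahnModule.of (LaurentSeries ℂ)).symm (f • G)).coeff n = 0 := by
    rw [HahnModule.coeff_smul]
    refine Finset.sum_eq_zero fun ij hij => ?_
    rw [Finset.mem_vaddAntidiagonal] at hij
    obtain ⟨h1, h2, h3⟩ := hij
    have h4 := HahnSeries.order_le_of_coeff_ne_zero h1
    have h5 : 0 ≤ ij.2 := by
      by_contra h5
      exact h2 (hG _ (not_le.mp h5))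
    rw [vadd_eq_add] at h3
    omega
  rw [iterCoeff, h]
  rfl

/-- The substituted series has no negative powers of `x₀`, so all poles in `x₀` come from `p(x + x₀,
x)⁻¹`, whose order is independent of `w`. This uniformity gives `Y_E(a, x₀)b ∈ V((x₀))`. -/
theorem exists_nthProduct_eq_zero {a b : E W} (h : QuasiCompatible ![a, b]) :
    ∃ N : ℤ, ∀ n < N, nthProduct a b (-n - 1) = 0 := by
  obtain ⟨p, hp, hc⟩ := (quasiCompatible_pair_iff a b).1 h
  refine ⟨((shiftedPoly p)⁻¹ : LaurentSeries (LaurentSeries ℂ)).order, fun n hn => ?_⟩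
  refine E.ext_coeff fun s w => ?_
  rw [coeff_nthProduct, YE_eq p hp a b hc]
  refine (iterCoeff_smul_eq_zero (fun m hm => ?_) hn s).trans (by simp)
  exact if_neg (not_le.mpr hm)

/-- The three pairs may have different denominators; uniqueness of substitution removes the need to
compare them. The three lemmas that follow use the same argument. -/
theorem nthProduct_add_left {a a' b : E W} (h : QuasiCompatible ![a, b])
    (h' : QuasiCompatible ![a', b]) (hs : QuasiCompatible ![a + a', b]) (n : ℤ) :
    nthProduct (a + a') b (-n - 1) = nthProduct a b (-n - 1) + nthProduct a' b (-n - 1) := by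
  refine E.ext_coeff fun s w => ?_
  have e := (isSubst_nthProduct hs w).unique
    (((isSubst_nthProduct h w).add (isSubst_nthProduct h' w)).congr_left (by funext m; simp))
  simpa using congrFun e ![n, s]

theorem nthProduct_add_right {a b b' : E W} (h : QuasiCompatible ![a, b])
    (h' : QuasiCompatible ![a, b']) (hs : QuasiCompatible ![a, b + b']) (n : ℤ) :
    nthProduct a (b + b') (-n - 1) = nthProduct a b (-n - 1) + nthProduct a b' (-n - 1) := by
  refine E.ext_coeff fun s w => ?_
  have e := (isSubst_nthProduct hs w).unique
    (((isSubst_nthProduct h w).add (isSubst_nthProduct h' w)).congr_left (by funext m; simp))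
  simpa using congrFun e ![n, s]

theorem nthProduct_smul_left {a b : E W} (c : ℂ) (h : QuasiCompatible ![a, b])
    (hs : QuasiCompatible ![c • a, b]) (n : ℤ) :
    nthProduct (c • a) b (-n - 1) = c • nthProduct a b (-n - 1) := by
  refine E.ext_coeff fun s w => ?_
  have e := (isSubst_nthProduct hs w).unique
    ((shiftSemilinear_isSubst.smul c _ _ (isSubst_nthProduct h w)).congr_left (by funext m; simp))
  simpa using congrFun e ![n, s]

theorem nthProduct_smul_right {a b : E W} (c : ℂ) (h : QuasiCompatible ![a, b])
    (hs : QuasiCompatible ![a, c • b]) (n : ℤ) :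
    nthProduct a (c • b) (-n - 1) = c • nthProduct a b (-n - 1) := by
  refine E.ext_coeff fun s w => ?_
  have e := (isSubst_nthProduct hs w).unique
    ((shiftSemilinear_isSubst.smul c _ _ (isSubst_nthProduct h w)).congr_left (by funext m; simp))
  simpa using congrFun e ![n, s]

theorem quasiCompatible_pair {V : Submodule ℂ (E W)}
    (h2 : ∀ ψ : Fin 2 → E W, (∀ i, ψ i ∈ V) → QuasiCompatible ψ) (a b : V) :
    QuasiCompatible ![(a : E W), b] :=
  h2 _ fun i => by fin_cases i <;> simp

/-- The vertex operator map `Y_E` of a closed subspace of `E(W)`. -/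
def vertexMap (V : Submodule ℂ (E W))
    (h2 : ∀ ψ : Fin 2 → E W, (∀ i, ψ i ∈ V) → QuasiCompatible ψ) (hV : IsClosedSubspace V) :
    V →ₗ[ℂ] E V where
  toFun a := VertexOperator.of_coeff
    (fun n =>
      { toFun := fun b => ⟨nthProduct a b (-n - 1), hV _ a.2 _ b.2 _⟩
        map_add' := fun b b' => Subtype.ext (nthProduct_add_right (quasiCompatible_pair h2 a b)
          (quasiCompatible_pair h2 a b') (quasiCompatible_pair h2 a (b + b')) n)
        map_smul' := fun c b => Subtype.ext (nthProduct_smul_right c (quasiCompatible_pair h2 a b)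
          (quasiCompatible_pair h2 a (c • b)) n) })
    (fun b => by
      obtain ⟨N, hN⟩ := exists_nthProduct_eq_zero (quasiCompatible_pair h2 a b)
      refine ⟨N, fun n hn => ?_⟩
      by_contra hlt
      exact hn (Subtype.ext (hN n (not_le.mp hlt))))
  map_add' a a' := E.ext_coeff fun n b => Subtype.ext
    (nthProduct_add_left (quasiCompatible_pair h2 a b) (quasiCompatible_pair h2 a' b)
      (quasiCompatible_pair h2 (a + a') b) n)
  map_smul' c a := E.ext_coeff fun n b => Subtype.ext
    (nthProduct_smul_left c (quasiCompatible_pair h2 a b) (quasiCompatible_pair h2 (c • a) b) n)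

variable {V : Submodule ℂ (E W)}
  {h2 : ∀ ψ : Fin 2 → E W, (∀ i, ψ i ∈ V) → QuasiCompatible ψ} {hV : IsClosedSubspace V}

theorem coeff_vertexMap (a b : V) (n : ℤ) :
    ((HVertexOperator.coeff (vertexMap V h2 hV a) n b : V) : E W) = nthProduct a b (-n - 1) :=
  rfl

theorem isSubst_vertexMap (a b : V) (w : W) :
    IsSubst (fun m => HVertexOperator.coeff (a : E W) (m 0)
        (HVertexOperator.coeff (b : E W) (m 1) w))
      (fun m => HVertexOperator.coeff
        ((HVertexOperator.coeff (vertexMap V h2 hV a) (m 0) b : V) : E W) (m 1) w) :=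
  isSubst_nthProduct (quasiCompatible_pair h2 a b) w

theorem coeff_idSeries (n : ℤ) (w : W) :
    HVertexOperator.coeff (idSeries W) n w = if n = 0 then w else 0 := by
  change (HahnSeries.single 0 w).coeff n = _
  by_cases h : n = 0 <;> simp [h]

/-- The product `1_W(x₁)b(x)w` is already lower truncated and free of `x₁`, so substitution leaves
`b(x)w` unchanged. -/
theorem vertexMap_one (h1 : idSeries W ∈ V) :
    vertexMap V h2 hV ⟨idSeries W, h1⟩ = idSeries V := by
  refine E.ext_coeff fun n b => Subtype.ext (E.ext_coeff fun s w => ?_)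
  set F : FormalSeries 2 W := fun m => HVertexOperator.coeff (idSeries W) (m 0)
    (HVertexOperator.coeff (b : E W) (m 1) w) with hF
  have hF0 (m) (hm : F m ≠ 0) : m 0 = 0 := by
    by_contra h
    exact hm (by rw [hF]; simp only [coeff_idSeries, if_neg h])
  have hlt : IsLowerTruncated F := by
    obtain ⟨N, hN⟩ := E.exists_lowerBound (b : E W) w
    refine ⟨min 0 N, fun m hm i => ?_⟩
    fin_cases i
    · simp [hF0 m hm]
    · refine (min_le_right _ _).trans (hN (m 1) fun h => hm ?_)
      simp only [hF, h, map_zero]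
  have e := congrFun ((isSubst_vertexMap (h2 := h2) (hV := hV) ⟨idSeries W, h1⟩ b w).eq_substSeries
    hlt) ![n, s]
  simp only [Matrix.cons_val_zero, Matrix.cons_val_one] at e
  rw [e, coeff_idSeries]
  by_cases hn : 0 ≤ n
  · rw [substSeries_eq_sum (by simpa using hn) {0}, Finset.sum_singleton]
    · simp only [Matrix.cons_val_zero, Matrix.cons_val_one, coeff_idSeries, if_true, sub_zero]
      by_cases h0 : n = 0
      · simp [h0]
      · rw [Ring.choose_zero_pos ℤ (by omega : 0 < n.toNat), zero_smul, if_neg h0]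
        simp
    · intro i hi
      by_contra h
      exact hi (by simpa using hF0 _ h)
  · rw [substSeries, if_neg (by simpa using hn), if_neg (by omega)]
    simp

/-- Here the product is `a(x₁)w`, and `a(x + x₀)w` has only nonnegative powers of `x₀`, with
constant term `a(x)w`. -/
theorem coeff_vertexMap_apply_one (h1 : idSeries W ∈ V) (a : V) {n : ℤ} (hn : n ≤ 0) :
    (HVertexOperator.coeff (vertexMap V h2 hV a) n (⟨idSeries W, h1⟩ : V) : V) =
      if n = 0 then a else 0 := by
  refine Subtype.ext (E.ext_coeff fun s w => ?_)
  set F : FormalSeries 2 W := fun m => HVertexOperator.coeff (a : E W) (m 0)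
    (HVertexOperator.coeff (idSeries W) (m 1) w) with hF
  have hF0 (m) (hm : F m ≠ 0) : m 1 = 0 := by
    by_contra h
    exact hm (by rw [hF]; simp only [coeff_idSeries, if_neg h, map_zero])
  have hlt : IsLowerTruncated F := by
    obtain ⟨N, hN⟩ := E.exists_lowerBound (a : E W) w
    refine ⟨min 0 N, fun m hm i => ?_⟩
    fin_cases i
    · refine (min_le_right _ _).trans (hN (m 0) fun h => hm ?_)
      simp only [hF, coeff_idSeries, if_pos (hF0 m hm), h]
    · simp [hF0 m hm]
  have e := congrFun ((isSubst_vertexMap (h2 := h2) (hV := hV) a ⟨idSeries W, h1⟩ w).eq_substSeries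
    hlt) ![n, s]
  simp only [Matrix.cons_val_zero, Matrix.cons_val_one] at e
  rw [e]
  rcases hn.lt_or_eq with hn | rfl
  · rw [substSeries, if_neg (by simpa using hn), if_neg hn.ne]
    simp
  · rw [substSeries_eq_sum (by simp) {s}, Finset.sum_singleton]
    · simp only [Matrix.cons_val_zero, Matrix.cons_val_one, Int.toNat_zero, Ring.choose_zero_right,
        one_smul, add_zero, sub_self, coeff_idSeries, if_true]
    · intro i hi
      by_contra h
      have := hF0 _ h
      simp at this
      exact hi (by simp; omega)

end VertexMap

/-! ### Quasi associativity on `W` and weak associativity on `V`. -/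

section Associativity

variable {W : Type*} [AddCommGroup W] [Module ℂ W]

theorem polyMul_X_pow_apply {r : ℕ} (i : Fin r) (k : ℕ) (F : FormalSeries r W) (m : Fin r → ℤ) :
    polyMul (X i ^ k) F m = F (fun j => m j - if j = i then (k : ℤ) else 0) := by
  induction k generalizing m with
  | zero => rw [pow_zero, ← C_1, polyMul_C, one_smul]; simp
  | succ k ih =>
    rw [pow_succ', polyMul_mul, polyMul_X_apply, ih]
    congr 1
    funext j
    split_ifs <;> push_cast <;> ring

theorem bind₁_shiftVar_zero_one (q : MvPolynomial (Fin 2) ℂ) :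
    bind₁ (shiftVar 0 1) q = bind₁ ![X 0 + X 1, X 1] q := by
  congr 2
  funext i
  fin_cases i <;> simp [shiftVar]

/-- Quasi associativity of a quasi compatible pair. -/
theorem exists_quasi_assoc {a b : E W} (h : QuasiCompatible ![a, b]) (w : W) :
    ∃ f : MvPolynomial (Fin 2) ℂ, f ≠ 0 ∧
      polyMul (bind₁ ![X 0 + X 1, X 1] f) (composeShifted a b w) =
        polyMul (bind₁ ![X 0 + X 1, X 1] f) (iterSeries (YE a b w)) := by
  obtain ⟨p, hp, hc⟩ := (quasiCompatible_pair_iff a b).1 h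
  obtain ⟨N, hN⟩ := hc w
  obtain ⟨M, hM⟩ := E.exists_lowerBound b w
  -- The exponents of the cleared product are at least `N`; the extra power of the first variable
  -- makes its exponents nonnegative, so that both expansions agree.
  have hlt : IsLowerTruncated (polyMul (X 0 ^ (-N).toNat * p) (opProd ![a, b] w)) := by
    rw [polyMul_mul]
    exact (hc w).polyMul _
  refine ⟨X 0 ^ (-N).toNat * p, mul_ne_zero (pow_ne_zero _ (X_ne_zero 0)) hp, ?_⟩
  rw [← bind₁_shiftVar_zero_one,
    ((isSubst_YE h w).polyMul (X 0 ^ (-N).toNat * p)).eq_substSeries hlt, composeShifted_eq]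
  have hexp : IsExpansion (opProd ![a, b] w) (expandSeries (opProd ![a, b] w)) := by
    refine ⟨⟨M, fun m hm => hM _ fun h => hm ?_⟩, rfl⟩
    rw [opProd_pair]
    simp only [h, map_zero]
  rw [(shiftSemilinear_isExpansion.polyMul hexp (X 0 ^ (-N).toNat * p)).2]
  obtain ⟨N', hN'⟩ := hlt
  refine expandSeries_eq_substSeries (N := N') (fun m hm => ?_) fun m hm => hN' m hm 1
  rw [polyMul_mul, polyMul_X_pow_apply] at hm
  have := hN _ hm 0
  simp at this
  omega

theorem exists_of_substSeries_ne_zero {U : Type*} [AddCommGroup U] {F : FormalSeries 2 U}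
    {m : Fin 2 → ℤ} (h : substSeries F m ≠ 0) : ∃ i, F ![i, m 1 + m 0 - i] ≠ 0 := by
  by_contra! h'
  refine h ?_
  rw [substSeries]
  split_ifs with h0
  · refine finsum_eq_zero_of_forall_eq_zero fun i => ?_
    rw [Int.toNat_of_nonneg h0, h', smul_zero]
  · rfl

/-- Makes the second substitution legitimate. The substitution preserves total degree, so the bound
on the exponent of `x₂` depends on that of `x₁`; truncation holds slice by slice only. -/
theorem isLowerTruncated_slice_subst_one_two {U : Type*} [AddCommGroup U] {F : FormalSeries 3 U}
    (hF : IsLowerTruncated F) (m : Fin 3 → ℤ) : IsLowerTruncated (slice 0 2 (alongSlices substSeries 1 2 F) m) := by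
  obtain ⟨N, hN⟩ := hF
  rw [slice_zero_two_three]
  refine ⟨min N (2 * N - m 1), fun n hn => ?_⟩
  change alongSlices substSeries 1 2 F ![n 0, m 1, n 1] ≠ 0 at hn
  rw [alongSlices, slice_one_two_three] at hn
  obtain ⟨i, hi⟩ := exists_of_substSeries_ne_zero hn
  have h0 := hN _ hi 0
  have h1 := hN _ hi 1
  have h2 := hN _ hi 2
  simp at h0 h1 h2
  refine Fin.forall_fin_two.2 ⟨?_, ?_⟩ <;> omega

theorem isLowerTruncated_slice_subst_zero_one {U : Type*} [AddCommGroup U] {F : FormalSeries 3 U}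
    (hF : IsLowerTruncated F) (m : Fin 3 → ℤ) : IsLowerTruncated (slice 1 2 (alongSlices substSeries 0 1 F) m) := by
  obtain ⟨N, hN⟩ := hF
  rw [slice_one_two_three]
  refine ⟨min N (2 * N - m 0), fun n hn => ?_⟩
  change alongSlices substSeries 0 1 F ![m 0, n 0, n 1] ≠ 0 at hn
  rw [alongSlices, slice_zero_one_three] at hn
  obtain ⟨i, hi⟩ := exists_of_substSeries_ne_zero hn
  have h0 := hN _ hi 0
  have h1 := hN _ hi 1
  have h2 := hN _ hi 2
  simp at h0 h1 h2
  refine Fin.forall_fin_two.2 ⟨?_, ?_⟩ <;> omega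

/-- If `H` becomes lower truncated in `x_u, x_v` after multiplication by `q`, then the substitution
`x_u ↦ x_v + x_u` is computed by `substSeries` after multiplication by the image of `q`. -/
theorem polyMul_shiftVar_eq_alongSlices {r : ℕ} {u v : Fin r} (huv : u ≠ v)
    {H G : FormalSeries r W} (h : ∀ m, IsSubst (slice u v H m) (slice u v G m))
    {q : MvPolynomial (Fin r) ℂ} (hq : ∀ m, IsLowerTruncated (slice u v (polyMul q H) m)) :
    polyMul (bind₁ (shiftVar u v) q) G = alongSlices substSeries u v (polyMul q H) :=
  eq_alongSlices fun m =>
    (shiftSemilinear_isSubst.slice_polyMul huv h q m).eq_substSeries (hq m)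

/-- With `bind₁_shiftVar_two`, this says that the two routes of successive substitution have the
same total effect on the multiplier. -/
theorem bind₁_shiftVar_three (q : MvPolynomial (Fin 3) ℂ) :
    bind₁ (shiftVar 0 1) (bind₁ (shiftVar 0 2) (bind₁ (shiftVar 1 2) q)) = shiftBoth q := by
  rw [← AlgHom.comp_apply, ← AlgHom.comp_apply]
  congr 1
  ext1 i
  fin_cases i
  · simp [shiftBoth, shiftVar, Function.update]
  · simp [shiftBoth, shiftVar, Function.update]
  · simp [shiftBoth, shiftVar, Function.update]

theorem bind₁_shiftVar_two (q : MvPolynomial (Fin 3) ℂ) :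
    bind₁ (shiftVar 1 2) (bind₁ (shiftVar 0 1) q) = shiftBoth q := by
  rw [← AlgHom.comp_apply]
  congr 1
  ext1 i
  fin_cases i
  · simp [shiftBoth, shiftVar, Function.update, add_assoc]
  · simp [shiftBoth, shiftVar, Function.update]
  · simp [shiftBoth, shiftVar, Function.update]

variable {U : Type*} [AddCommGroup U] [Module ℂ U] (Y : U →ₗ[ℂ] E U) (YW : U →ₗ[ℂ] E W)

/-- The coefficients of `Y_W(Y(a, x₀) Y(b, x₁) c, x₂) w`. -/
def productSeries (a b c : U) (w : W) : FormalSeries 3 W := fun m =>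
  HVertexOperator.coeff (YW (HVertexOperator.coeff (Y a) (m 0)
    (HVertexOperator.coeff (Y b) (m 1) c))) (m 2) w

/-- The coefficients of `Y_W(Y(Y(a, x₀) b, x₁) c, x₂) w`. -/
def iterateSeriesThree (a b c : U) (w : W) : FormalSeries 3 W := fun m =>
  HVertexOperator.coeff (YW (HVertexOperator.coeff (Y (HVertexOperator.coeff (Y a) (m 0) b))
    (m 1) c)) (m 2) w

/-- `Y_W(Y(a, x₀) b, x) w` is obtained from `Y_W(a, x₁) Y_W(b, x) w` by the substitution
`x₁ = x + x₀`. -/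
def IsSubstProduct : Prop :=
  ∀ a b w, IsSubst
    (fun m => HVertexOperator.coeff (YW a) (m 0) (HVertexOperator.coeff (YW b) (m 1) w))
    (fun m => HVertexOperator.coeff (YW (HVertexOperator.coeff (Y a) (m 0) b)) (m 1) w)

/-- `Y(b, x₁)c` bounds `x₁` first, and the bound for `x₀` then depends on the chosen coefficient;
for the iterate below the roles of `x₀` and `x₁` are exchanged. This difference is the obstacle to
direct cancellation. -/
theorem isNested_productSeries (a b c : U) (w : W) :
    IsNested 1 0 (productSeries Y YW a b c w) where
  outer := by
    obtain ⟨N, hN⟩ := E.exists_lowerBound (Y b) c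
    refine ⟨N, fun m hm => hN _ fun h => hm ?_⟩
    simp only [productSeries, h, map_zero, Pi.zero_apply, LinearMap.zero_apply]
  middle k := by
    obtain ⟨N, hN⟩ := E.exists_lowerBound (Y a) (HVertexOperator.coeff (Y b) k c)
    refine ⟨N, fun m hk hm => hN _ fun h => hm ?_⟩
    simp only [productSeries, hk, h, map_zero, Pi.zero_apply, LinearMap.zero_apply]
  inner j k := E.exists_lowerBound
    (YW (HVertexOperator.coeff (Y a) j (HVertexOperator.coeff (Y b) k c))) w

theorem isNested_iterateSeriesThree (a b c : U) (w : W) :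
    IsNested 0 1 (iterateSeriesThree Y YW a b c w) where
  outer := by
    obtain ⟨N, hN⟩ := E.exists_lowerBound (Y a) b
    refine ⟨N, fun m hm => hN _ fun h => hm ?_⟩
    simp only [iterateSeriesThree, h, map_zero, Pi.zero_apply, LinearMap.zero_apply]
  middle k := by
    obtain ⟨N, hN⟩ := E.exists_lowerBound (Y (HVertexOperator.coeff (Y a) k b)) c
    refine ⟨N, fun m hk hm => hN _ fun h => hm ?_⟩
    simp only [iterateSeriesThree, hk, h, map_zero, Pi.zero_apply, LinearMap.zero_apply]
  inner j k := E.exists_lowerBound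
    (YW (HVertexOperator.coeff (Y (HVertexOperator.coeff (Y a) j b)) k c)) w

variable {Y YW}

/-- The right-hand operators `b`, `c` are merged first and `a` is merged with the result; replacing
`x₀` by `x₀ + x₁` then brings the answer to the form produced by the other route. -/
theorem shiftBoth_polyMul_expand_productSeries
    (hY : IsSubstProduct Y YW)
    {R : MvPolynomial (Fin 3) ℂ} {a b c : U} (hR : Clears R ![YW a, YW b, YW c]) (w : W) :
    polyMul (shiftBoth R) (alongSlices expandSeries 0 1 (productSeries Y YW a b c w)) =
      alongSlices substSeries 1 2 (alongSlices substSeries 0 1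
        (polyMul R (opProd ![YW a, YW b, YW c] w))) := by
  set F := polyMul R (opProd ![YW a, YW b, YW c] w)
  let H : FormalSeries 3 W := fun m => HVertexOperator.coeff (YW a) (m 0)
    (HVertexOperator.coeff (YW (HVertexOperator.coeff (Y b) (m 1) c)) (m 2) w)
  have e1 : polyMul (bind₁ (shiftVar 1 2) R) H = alongSlices substSeries 1 2 F := by
    refine polyMul_shiftVar_eq_alongSlices (by decide) (fun m => ?_)
      fun m => (hR w).slice (by decide) m
    rw [slice_one_two_three, slice_one_two_three, opProd_triple]
    exact (hY b c w).map (HVertexOperator.coeff (YW a) (m 0))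
  have e2 : polyMul (bind₁ (shiftVar 0 2) (bind₁ (shiftVar 1 2) R)) (productSeries Y YW a b c w) =
      alongSlices substSeries 0 2 (alongSlices substSeries 1 2 F) := by
    rw [← e1]
    refine polyMul_shiftVar_eq_alongSlices (by decide) (fun m => ?_) fun m => ?_
    · rw [slice_zero_two_three, slice_zero_two_three]
      exact hY a (HVertexOperator.coeff (Y b) (m 1) c) w
    · rw [e1]
      exact isLowerTruncated_slice_subst_one_two (hR w) m
  rw [← expand_subst_subst (hR w), ← e2, ← bind₁_shiftVar_three]
  refine eq_alongSlices fun m => (shiftSemilinear_isExpansion.slice_polyMul (by decide)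
    (fun m => ⟨?_, slice_alongSlices _ (by decide) _ _⟩) _ m).2
  obtain ⟨N, hN⟩ := (isNested_productSeries Y YW a b c w).outer
  refine ⟨N, fun n hn => ?_⟩
  rw [slice_zero_one_three] at hn
  exact hN _ hn

/-- The other route: `a` and `b` are merged first, and the result is merged with `c`. -/
theorem shiftBoth_polyMul_iterateSeriesThree
    (hY : IsSubstProduct Y YW)
    {R : MvPolynomial (Fin 3) ℂ} {a b c : U} (hR : Clears R ![YW a, YW b, YW c]) (w : W) :
    polyMul (shiftBoth R) (iterateSeriesThree Y YW a b c w) =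
      alongSlices substSeries 1 2 (alongSlices substSeries 0 1
        (polyMul R (opProd ![YW a, YW b, YW c] w))) := by
  set F := polyMul R (opProd ![YW a, YW b, YW c] w)
  let H : FormalSeries 3 W := fun m =>
    HVertexOperator.coeff (YW (HVertexOperator.coeff (Y a) (m 0) b)) (m 1)
      (HVertexOperator.coeff (YW c) (m 2) w)
  have e1 : polyMul (bind₁ (shiftVar 0 1) R) H = alongSlices substSeries 0 1 F := by
    refine polyMul_shiftVar_eq_alongSlices (by decide) (fun m => ?_)
      fun m => (hR w).slice (by decide) m
    rw [slice_zero_one_three, slice_zero_one_three, opProd_triple]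
    exact hY a b (HVertexOperator.coeff (YW c) (m 2) w)
  rw [← e1, ← bind₁_shiftVar_two]
  refine polyMul_shiftVar_eq_alongSlices (by decide) (fun m => ?_) fun m => ?_
  · rw [slice_one_two_three, slice_one_two_three]
    exact hY (HVertexOperator.coeff (Y a) (m 0) b) c w
  · rw [e1]
    exact isLowerTruncated_slice_subst_zero_one (hR w) m

/-- The exponent is the multiplicity of `x₀ - x₁` in `p`, hence uniform in `w`. -/
theorem exists_pow_mul_expand_eq
    (hY : IsSubstProduct Y YW)
    {a b c : U} (h : QuasiCompatible ![YW a, YW b, YW c]) :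
    ∃ l : ℕ, ∀ w : W, polyMul ((X 0 + X 1) ^ l)
        (alongSlices expandSeries 0 1 (productSeries Y YW a b c w)) =
      polyMul ((X 0 + X 1) ^ l) (iterateSeriesThree Y YW a b c w) := by
  obtain ⟨p, hp, hc⟩ := h
  obtain ⟨l, q, hq, hfac⟩ := exists_shiftBoth_pairwiseProd_eq hp
  refine ⟨l, fun w => ?_⟩
  have eA := shiftBoth_polyMul_expand_productSeries hY hc w
  have eB := shiftBoth_polyMul_iterateSeriesThree hY hc w
  set S := alongSlices substSeries 1 2 (alongSlices substSeries 0 1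
        (polyMul (pairwiseProd 3 p) (opProd ![YW a, YW b, YW c] w)))
  have hS : ∀ m, S m ≠ 0 → 0 ≤ m 0 ∧ 0 ≤ m 1 := fun m hm => by
    refine ⟨?_, ?_⟩
    · by_contra h0
      refine hm ?_
      by_contra hm'
      obtain ⟨i, hi⟩ := exists_of_substSeries_ne_zero hm'
      rw [slice_one_two_three] at hi
      exact hi (alongSlices_subst_eq_zero _ (by simpa using h0))
    · by_contra h1
      exact hm (alongSlices_subst_eq_zero _ (not_le.mp h1))
  have hA := ((isNested_productSeries Y YW a b c w).expand).polyMul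
    (X 0 ^ l * (X 1 ^ l * (X 0 + X 1) ^ l))
  have hB := (isNested_iterateSeriesThree Y YW a b c w).polyMul
    (X 0 ^ l * (X 1 ^ l * (X 0 + X 1) ^ l))
  set A := alongSlices expandSeries 0 1 (productSeries Y YW a b c w)
  set B := iterateSeriesThree Y YW a b c w
  rw [hfac, polyMul_mul] at eA eB
  set A' := polyMul (X 0 ^ l * (X 1 ^ l * (X 0 + X 1) ^ l)) A with hA'
  set B' := polyMul (X 0 ^ l * (X 1 ^ l * (X 0 + X 1) ^ l)) B with hB'
  -- Exponents outside the nonnegative quadrant form a lower set, over which `S`, the common product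
  -- of `q` with `A'` and with `B'`, vanishes. Hence `A'` and `B'` vanish there, each by
  -- cancellation in its own space.
  have hD : IsLowerSet {p : ℤ × ℤ | ¬ (0 ≤ p.1 ∧ 0 ≤ p.2)} := fun p p' hle hp h =>
    hp ⟨h.1.trans hle.1, h.2.trans hle.2⟩
  have zA : ∀ m, ¬ (0 ≤ m 0 ∧ 0 ≤ m 1) → A' m = 0 := fun m hm =>
    hA.eq_zero_of_polyMul (Or.inr ⟨rfl, rfl⟩) hq hD
      (fun m hm => by rw [eA]; by_contra h; exact hm (hS m h)) m hm
  have zB : ∀ m, ¬ (0 ≤ m 0 ∧ 0 ≤ m 1) → B' m = 0 := fun m hm =>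
    hB.eq_zero_of_polyMul (Or.inl ⟨rfl, rfl⟩) hq hD
      (fun m hm => by rw [eB]; by_contra h; exact hm (hS m h)) m hm
  have hpos (m) (hm : (A' - B') m ≠ 0) : 0 ≤ m 0 ∧ 0 ≤ m 1 := by
    by_contra h
    exact hm (by rw [Pi.sub_apply, zA m h, zB m h, sub_zero])
  -- With nonnegative exponents in `x₀` and `x₁`, the order of nesting no longer matters, so the
  -- difference lies in a single space and `q` can be cancelled from it.
  have hsub : IsNested 0 1 (A' - B') := by
    refine ⟨⟨0, fun m hm => (hpos m hm).1⟩, fun _ => ⟨0, fun m _ hm => (hpos m hm).2⟩,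
      fun j k => ?_⟩
    obtain ⟨N, hN⟩ := hA.inner j k
    obtain ⟨M, hM⟩ := hB.inner j k
    refine ⟨min N M, fun s hs => ?_⟩
    by_cases h : A' ![j, k, s] = 0
    · refine (min_le_right _ _).trans (hM s fun h' => hs ?_)
      rw [Pi.sub_apply, h, h', sub_zero]
    · exact (min_le_left _ _).trans (hN s h)
  have hzero : A' - B' = 0 := funext fun m =>
    hsub.eq_zero_of_polyMul (Or.inl ⟨rfl, rfl⟩) hq isLowerSet_univ
      (fun m _ => by rw [polyMul_sub_right, eA, eB, sub_self]; rfl) m trivial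
  -- Multiplication by a variable is injective on all formal series; multiplication by `x₀ + x₁` is
  -- not, so its power stays.
  rw [hA', hB', polyMul_mul, polyMul_mul, polyMul_mul, polyMul_mul, ← polyMul_sub_right,
    ← polyMul_sub_right] at hzero
  exact sub_eq_zero.mp (polyMul_X_pow_eq_zero (polyMul_X_pow_eq_zero hzero))

theorem slice_zero_one_polyMul_pow (l : ℕ) (F : FormalSeries 3 W) (m : Fin 3 → ℤ) :
    slice 0 1 (polyMul ((X 0 + X 1) ^ l) F) m = polyMul ((X 0 + X 1) ^ l) (slice 0 1 F m) := by
  have := polyMul_rel (r := 3) (r' := 2) (Rel := fun F G => slice 0 1 F m = G)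
    (g := ![X 0, X 1]) (h := X) (by rintro F F' _ _ rfl rfl; rfl) (by rintro c F _ rfl; rfl)
    (fun i F G h => ?_) ((X 0 + X 1) ^ l) (F := F) rfl
  · simpa only [map_pow, map_add, bind₁_X_right, Matrix.cons_val_zero, Matrix.cons_val_one,
      bind₁_X_left, AlgHom.id_apply] using this
  · subst h
    fin_cases i
    · exact slice_polyMul_X_left (by decide) F m
    · exact slice_polyMul_X_right (by decide) F m

theorem expandSeries_map {U U' : Type*} [AddCommGroup U] [Module ℂ U] [AddCommGroup U'] [Module ℂ U']
    (f : U →ₗ[ℂ] U')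
    {F : FormalSeries 2 U} {N : ℤ} (hN : ∀ m, F m ≠ 0 → N ≤ m 1) (m : Fin 2 → ℤ) :
    f (expandSeries F m) = expandSeries (fun m => f (F m)) m := by
  obtain ⟨K, hK⟩ : ∃ K : ℕ, m 1 - K < N := ⟨(m 1 - N + 1).toNat, by omega⟩
  rw [expandSeries_eq_sum hN m hK, expandSeries_eq_sum (N := N) (fun m hm => hN m fun h =>
    hm (by simp [h])) m hK, map_sum]
  exact Finset.sum_congr rfl fun k _ => map_zsmul f.toAddMonoidHom _ _

/-- The identity on `W` is read off coefficient by coefficient in `x₂`; this needs one `l` for all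
`w` and all exponents `s`. -/
theorem exists_weak_assoc (hYW : Function.Injective YW)
    (hY : IsSubstProduct Y YW)
    {a b c : U} (h : QuasiCompatible ![YW a, YW b, YW c]) :
    ∃ l : ℕ, polyMul ((X 0 + X 1) ^ l) (composeShifted (Y a) (Y b) c) =
      polyMul ((X 0 + X 1) ^ l) (iterateSeries Y Y a b c) := by
  obtain ⟨l, hl⟩ := exists_pow_mul_expand_eq hY h
  refine ⟨l, funext fun m => hYW (E.ext_coeff fun s w => ?_)⟩
  -- As `s` and `w` vary, these maps separate the points of `U`, because `YW` is injective.
  let f : U →ₗ[ℂ] W :=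
    { toFun := fun a => HVertexOperator.coeff (YW a) s w
      map_add' := fun a b => by simp only [map_add, Pi.add_apply, LinearMap.add_apply]
      map_smul' := fun c a => by
        simp only [map_smul, Pi.smul_apply, LinearMap.smul_apply, RingHom.id_apply] }
  have e : (fun m => f (composeShifted (Y a) (Y b) c m)) =
      slice 0 1 (alongSlices expandSeries 0 1 (productSeries Y YW a b c w)) ![0, 0, s] := by
    obtain ⟨N, hN⟩ := E.exists_lowerBound (Y b) c
    have hN' : ∀ m, opProd ![Y a, Y b] c m ≠ 0 → N ≤ m 1 := fun m hm => hN (m 1) fun h => hm (by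
      rw [opProd_pair]
      simp only [h, map_zero])
    have e0 : slice 0 1 (productSeries Y YW a b c w) ![0, 0, s] =
        fun n => f (opProd ![Y a, Y b] c n) := by
      rw [slice_zero_one_three, opProd_pair]
      rfl
    rw [slice_alongSlices _ (by decide), e0, composeShifted_eq]
    exact funext fun m => expandSeries_map f hN' m
  have e' : (fun m => f (iterateSeries Y Y a b c m)) =
      slice 0 1 (iterateSeriesThree Y YW a b c w) ![0, 0, s] := by
    rw [slice_zero_one_three]
    rfl
  have key : polyMul ((X 0 + X 1) ^ l) (fun m => f (composeShifted (Y a) (Y b) c m)) =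
      polyMul ((X 0 + X 1) ^ l) (fun m => f (iterateSeries Y Y a b c m)) := by
    rw [e, e', ← slice_zero_one_polyMul_pow, ← slice_zero_one_polyMul_pow, hl w]
  rw [polyMul_map f, polyMul_map f] at key
  exact congrFun key m

theorem isSubstProduct_vertexMap {V : Submodule ℂ (E W)}
    {h2 : ∀ ψ : Fin 2 → E W, (∀ i, ψ i ∈ V) → QuasiCompatible ψ} {hV : IsClosedSubspace V} :
    IsSubstProduct (vertexMap V h2 hV) V.subtype := fun a b w =>
  isSubst_nthProduct (quasiCompatible_pair h2 a b) w

end Associativity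

end QuasiVertex

end

/-! ### Assembly of the theorem. -/

theorem theorem2p17 {W : Type*} [AddCommGroup W] [Module ℂ W]
    (V : Submodule ℂ (QuasiVertex.E W))
    (h2 : ∀ ψ : Fin 2 → QuasiVertex.E W, (∀ i, ψ i ∈ V) → QuasiVertex.QuasiCompatible ψ)
    (h3 : ∀ ψ : Fin 3 → QuasiVertex.E W, (∀ i, ψ i ∈ V) → QuasiVertex.QuasiCompatible ψ)
    (h1 : QuasiVertex.idSeries W ∈ V) (hV : QuasiVertex.IsClosedSubspace V) :
    ∃ (Y : V →ₗ[ℂ] QuasiVertex.E V) (YW : V →ₗ[ℂ] QuasiVertex.E W),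
      (∀ (a b : V) (n : ℤ),
        (VertexOperator.ncoeff (Y a) n b : QuasiVertex.E W) = QuasiVertex.nthProduct ↑a ↑b n) ∧
      (∀ a : V, YW a = (a : QuasiVertex.E W)) ∧
      QuasiVertex.IsNonlocalVertexAlgebra Y ⟨QuasiVertex.idSeries W, h1⟩ ∧
      QuasiVertex.IsQuasiModule Y ⟨QuasiVertex.idSeries W, h1⟩ YW ∧
      Function.Injective YW := by
  refine ⟨QuasiVertex.vertexMap V h2 hV, V.subtype, fun a b n => ?_, fun a => rfl,
    ⟨QuasiVertex.vertexMap_one h1, fun v n hn => ?_, fun v => ?_, fun u v w => ?_⟩,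
    ⟨rfl, fun u v w => ?_⟩, V.injective_subtype⟩
  · rw [VertexOperator.ncoeff_apply, QuasiVertex.coeff_vertexMap]
    congr 1
    ring
  · rw [QuasiVertex.coeff_vertexMap_apply_one h1 v hn.le, if_neg hn.ne]
  · rw [QuasiVertex.coeff_vertexMap_apply_one h1 v le_rfl, if_pos rfl]
  · have h : QuasiVertex.QuasiCompatible ![V.subtype u, V.subtype v, V.subtype w] :=
      h3 _ fun i => by
        fin_cases i
        exacts [u.2, v.2, w.2]
    exact QuasiVertex.exists_weak_assoc V.injective_subtype
      QuasiVertex.isSubstProduct_vertexMap h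
  · obtain ⟨f, hf, e⟩ :=
      QuasiVertex.exists_quasi_assoc (QuasiVertex.quasiCompatible_pair h2 u v) w
    have e' : QuasiVertex.iterSeries (QuasiVertex.YE (u : QuasiVertex.E W) v w) =
        QuasiVertex.iterateSeries (QuasiVertex.vertexMap V h2 hV) V.subtype u v w :=
      funext fun m => (QuasiVertex.coeff_nthProduct (u : QuasiVertex.E W) v (m 0) (m 1) w).symm
    rw [e'] at e
    exact ⟨f, hf, e⟩
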